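/- **Algebras.** For an index set $I$, a modal substitution algebra of dimension $I$ is a Boolean algebra with unary operations $\square$, $\mathsf c_i$, $\mathsf s_i^j$ ($i,j\in I$) satisfying, for all $i,j,k,l\in I$: $\square 1=1$; $\square(-x\vee y)\le -\square x\vee\square y$; $\mathsf c_j0=0$; $x\le \mathsf c_ix$; $\mathsf c_i(x\wedge \mathsf c_iy)=\mathsf c_ix\wedge \mathsf c_iy$; $\mathsf c_i(x\vee y)=\mathsf c_ix\vee \mathsf c_iy$; $\mathsf c_i\mathsf c_jx=\mathsf c_j\mathsf c_ix$; $\mathsf s_i^ix=x$; each $\mathsf s_i^j$ is a Boolean endomorphism that commutes with $\square$; $\mathsf s_j^i\mathsf c_ix=\mathsf c_ix$; $\mathsf c_i\mathsf s_j^ix=\mathsf s_j^ix$ if $i\ne j$; $\mathsf s_j^i\mathsf c_kx=\mathsf c_k\mathsf s_j^ix$ if $k\notin\{i,j\}$; $\mathsf c_i\mathsf s_i^jx=\mathsf c_j\mathsf s_j^ix$; $\mathsf s_i^j\mathsf s_k^lx=\mathsf s_k^l\mathsf s_i^jx$ if $i,j,k,l$ are distinct; $\mathsf s_i^l\mathsf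 s_l^jx=\mathsf s_i^l\mathsf s_i^jx$. Put $\Diamond x=-\square-x$, $\mathsf q_ix=-\mathsf c_i-x$, $\Delta x=\{i:\mathsf c_ix\ne x\}$. The algebra is dimension complemented if $I\smallsetminus\Delta x$ is infinite for every $x$. Let $\Lambda$ be a set of axioms among $\Diamond 1=1$ (D), $-\square p\vee p=1$ (T), $-\square p\vee\square\square p=1$ (4). For an ordinal $\gamma$ let $L_\gamma$ be the class of dimension complemented modal substitution algebras of dimension $\gamma$ that validate $\Lambda$. Let $\alpha$ be an infinite ordinal, $\beta$ an ordinal, and $\rho:\beta\to\wp(\alpha)$ such that $\alpha\smallsetminus\bigcup_{\eta\in\Gamma}\rho(\eta)$ is infinite for every finite $\Gamma\subseteq\beta$. For $\gamma\ge\alpha$ let $\mathfrak{Fr}_\beta^\rho L_\gamma$ be the dimension restricted free algebra: the quotient of the absolutely free algebra on generators $\eta<\beta$ by the intersection of all congruences $\theta$ such that the quotient by $\theta$ embeds in a member of $L_\gamma$ and $\mathsf c_k\eta\mathrel\theta\eta$ for all $\eta<\beta$ and $k\notin\rho(\eta)$. Put $A=\mathfrak{Fr}_\beta^\rho L_\alpha$,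 $B_n=\mathfrak{Fr}_\beta^\rho L_{\alpha+\omega\cdot n}$ for $n\in\omega$, and $B_\infty=\mathfrak{Fr}_\beta^\rho L_{\alpha+\omega\cdot\omega}$, with $A\subseteq B_n\subseteq B_\infty$ through the canonical embeddings, which fix the generators. Let $X_1,X_2\subseteq A$ be arbitrary subsets, and let $\mathrm{Sg}^{B}X$ be the subalgebra of $B$ generated by $X$. **Saturated pairs.** Write $\Gamma\to\Gamma'$ if some finite meet of elements of $\Gamma$ is $\le$ some finite join of elements of $\Gamma'$ (empty meet $=1$, empty join $=0$). A pair $(T,F)$ is $(X_1,X_2,B_n)$-saturated if, with $S_i=\mathrm{Sg}^{B_n}X_i$: 1. $T\subseteq S_1$, and $T\to\{a\}$ with $a\in S_1$ implies $a\in T$; $F\subseteq S_2$, and $\{a\}\to F$ with $a\in S_2$ implies $a\in F$; 2. $T\cap F=\emptyset$; 3. for $a,b\in S_1$, $a\vee b\in T$ implies $a\in T$ or $b\in T$; 4. for $a\in S_1$ and $k<\alpha+\omega\cdot n$, $\mathsf c_ka\in T$ implies $\mathsf s_j^ka\in T$ for some $j<\alpha+\omega\cdot n$ with $j\notin\Delta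 a$; 5. for $a,b\in S_2$, $a\wedge b\in F$ implies $a\in F$ or $b\in F$; 6. for $a\in S_2$ and $k<\alpha+\omega\cdot n$, $\mathsf q_ka\in F$ implies $\mathsf s_j^ka\in F$ for some $j<\alpha+\omega\cdot n$ with $j\notin\Delta a$. In 4 and 6, $\Delta a$ is taken in $B_n$. **Canonical Kripke system.** $W$ is the set of pairs $(T,F)$ of subsets of $B_\infty$ that are $(X_1,X_2,B_n)$-saturated for some $n\in\omega$. The least such $n$ is the level of the pair, and $D_{(T,F)}=\alpha+\omega\cdot n$ for that $n$. For $(T,F),(T',F')\in W$ of levels $n,m$, put $(T,F)\,R\,(T',F')$ iff $n\le m$, and $\square a\in T$ implies $a\in T'$ for all $a\in \mathrm{Sg}^{B_n}X_1$, and $\Diamond b\in F$ implies $b\in F'$ for all $b\in\mathrm{Sg}^{B_n}X_2$. **Theorem.** 1. If $\alpha$ and $\beta$ are countable and $A\models\Diamond 1=1$, then $R$ is serial: $\forall x\,\exists y\; xRy$. 2. If $A\models-\square p\vee p=1$, then $R$ is reflexive. 3. If $A\models-\square p\vee\square\square p=1$, then $R$ is transitive. In particular, if (D) $\in\Lambda$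 and $\alpha,\beta$ are countable then $R$ is serial; if (T) $\in\Lambda$ then $R$ is reflexive; if (4) $\in\Lambda$ then $R$ is transitive. This covers the quantified versions of D, T, K4, D4 and S4. -/

import Mathlib

universe u v

namespace QML

/-- A modal algebra: a Boolean algebra with a normal necessity operator `□`. -/
class ModalAlgebra (A : Type v) extends BooleanAlgebra A where
  box : A → A
  box_top : box ⊤ = ⊤
  box_imp : ∀ x y : A, box (xᶜ ⊔ y) ≤ (box x)ᶜ ⊔ box y

/-- Necessity `□ x`. -/
def box {A : Type v} [ModalAlgebra A] (x : A) : A := ModalAlgebra.box x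

/-- Possibility `◇ x = ¬ □ ¬ x`. -/
def dia {A : Type v} [ModalAlgebra A] (x : A) : A := (box xᶜ)ᶜ

/-- The modal axioms `◇⊤`, `□p → p` and `□p → □□p`. Sets of these axioms give the logics
`K`, `D`, `T`, `K4`, `D4`, `S4`. -/
inductive ModalAxiom : Type
  | D
  | T
  | four

/-- Validity of a modal axiom in a modal algebra. -/
def ModalAxiom.Valid (A : Type v) [ModalAlgebra A] : ModalAxiom → Prop
  | .D => dia (⊤ : A) = ⊤
  | .T => ∀ p : A, (box p)ᶜ ⊔ p = ⊤
  | .four => ∀ p : A, (box p)ᶜ ⊔ box (box p) = ⊤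

/-- A modal substitution algebra whose dimension is the index set `I`; `c i` is the
cylindrification `c_i`, and `s i j` is the substitution `s_i^j` (`i` is substituted for `j`). -/
class MSA (I : Type u) (A : Type v) [ModalAlgebra A] where
  c : I → A → A
  s : I → I → A → A
  c_bot : ∀ j, c j ⊥ = ⊥
  le_c : ∀ i x, x ≤ c i x
  c_inf_c : ∀ i x y, c i (x ⊓ c i y) = c i x ⊓ c i y
  c_sup : ∀ i x y, c i (x ⊔ y) = c i x ⊔ c i y
  c_comm : ∀ i j x, c i (c j x) = c j (c i x)
  s_self : ∀ i x, s i i x = x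
  s_sup : ∀ i j x y, s i j (x ⊔ y) = s i j x ⊔ s i j y
  s_inf : ∀ i j x y, s i j (x ⊓ y) = s i j x ⊓ s i j y
  s_compl : ∀ i j x, s i j xᶜ = (s i j x)ᶜ
  s_bot : ∀ i j, s i j ⊥ = ⊥
  s_top : ∀ i j, s i j ⊤ = ⊤
  s_box : ∀ i j x, s i j (box x) = box (s i j x)
  s_c_same : ∀ i j x, s j i (c i x) = c i x
  c_s_same : ∀ i j x, i ≠ j → c i (s j i x) = s j i x
  s_c_comm : ∀ i j k x, k ≠ i → k ≠ j → s j i (c k x) = c k (s j i x)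
  c_s_swap : ∀ i j x, c i (s i j x) = c j (s j i x)
  s_comm : ∀ i j k l x, i ≠ j → i ≠ k → i ≠ l → j ≠ k → j ≠ l → k ≠ l →
    s i j (s k l x) = s k l (s i j x)
  s_s : ∀ i j l x, s i l (s l j x) = s i l (s i j x)

section Basic

variable (I : Type u) {A : Type v} [ModalAlgebra A] [MSA I A]

/-- The dimension set `Δ x = {i : c_i x ≠ x}`. -/
def dimSet (x : A) : Set I := {i | MSA.c i x ≠ x}

/-- The universal quantifier `q_i = - c_i -`. -/
def univ {I : Type u} {A : Type v} [ModalAlgebra A] [MSA I A] (i : I) (x : A) : A :=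
  (MSA.c i xᶜ)ᶜ

/-- `Sg X`: the subalgebra generated by `X`. -/
inductive Sg (X : Set A) : A → Prop
  | basic (x : A) : x ∈ X → Sg X x
  | bot : Sg X ⊥
  | top : Sg X ⊤
  | sup (x y : A) : Sg X x → Sg X y → Sg X (x ⊔ y)
  | inf (x y : A) : Sg X x → Sg X y → Sg X (x ⊓ y)
  | compl (x : A) : Sg X x → Sg X xᶜ
  | box (x : A) : Sg X x → Sg X (box x)
  | c (i : I) (x : A) : Sg X x → Sg X (MSA.c i x)
  | s (i j : I) (x : A) : Sg X x → Sg X (MSA.s i j x)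

/-- The subalgebra generated by `X`, as a set. -/
def sg (X : Set A) : Set A := {x | Sg I X x}

/-- `Γ → Δ`: some finite meet of elements of `Γ` lies below some finite join of elements
of `Δ` (the empty meet is `1`, the empty join is `0`). -/
def Entails {A : Type v} [ModalAlgebra A] (Γ Δ : Set A) : Prop :=
  ∃ s t : Finset A, (s : Set A) ⊆ Γ ∧ (t : Set A) ⊆ Δ ∧ s.inf id ≤ t.sup id

/-- `T` is a theory of the subalgebra with universe `S`. -/
def IsTheory {A : Type v} [ModalAlgebra A] (S T : Set A) : Prop :=
  T ⊆ S ∧ ∀ a ∈ S, Entails T {a} → a ∈ T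

/-- `F` is a cotheory of the subalgebra with universe `S`. -/
def IsCotheory {A : Type v} [ModalAlgebra A] (S F : Set A) : Prop :=
  F ⊆ S ∧ ∀ a ∈ S, Entails {a} F → a ∈ F

/-- `(T, F)` is an `(A, X₁, X₂)`-saturated pair. -/
structure Saturated (X₁ X₂ T F : Set A) : Prop where
  theory : IsTheory (sg I X₁) T
  cotheory : IsCotheory (sg I X₂) F
  disjoint : T ∩ F = ∅
  prime_left : ∀ a ∈ sg I X₁, ∀ b ∈ sg I X₁, a ⊔ b ∈ T → a ∈ T ∨ b ∈ T
  witness_left : ∀ a ∈ sg I X₁, ∀ k : I, MSA.c k a ∈ T →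
    ∃ j : I, j ∉ dimSet I a ∧ MSA.s j k a ∈ T
  prime_right : ∀ a ∈ sg I X₂, ∀ b ∈ sg I X₂, a ⊓ b ∈ F → a ∈ F ∨ b ∈ F
  witness_right : ∀ a ∈ sg I X₂, ∀ k : I, univ k a ∈ F →
    ∃ j : I, j ∉ dimSet I a ∧ MSA.s j k a ∈ F

variable (A)

/-- Dimension complemented algebras: the complement of every dimension set is infinite. -/
def IsDc : Prop := ∀ x : A, (dimSet I x)ᶜ.Infinite

/-- The class of dimension complemented algebras that validate the modal axioms in `Λ`. -/
def InClass (Λ : Set ModalAxiom) : Prop := IsDc I A ∧ ∀ φ ∈ Λ, φ.Valid A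

end Basic

/-! Dimension restricted free algebras. -/

/-- The absolutely free algebra of the type of `I`-dimensional modal substitution algebras
with generators `G`. -/
inductive Term (I G : Type u) : Type u
  | var : G → Term I G
  | bot : Term I G
  | top : Term I G
  | sup : Term I G → Term I G → Term I G
  | inf : Term I G → Term I G → Term I G
  | compl : Term I G → Term I G
  | box : Term I G → Term I G
  | c : I → Term I G → Term I G
  | s : I → I → Term I G → Term I G

namespace Term

/-- The homomorphism from the absolutely free algebra to `A` that extends `y`. -/
def eval {I G : Type u} {A : Type v} [ModalAlgebra A] [MSA I A] (y : G → A) : Term I G → A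
  | var g => y g
  | bot => ⊥
  | top => ⊤
  | sup t r => t.eval y ⊔ r.eval y
  | inf t r => t.eval y ⊓ r.eval y
  | compl t => (t.eval y)ᶜ
  | box t => QML.box (t.eval y)
  | c i t => MSA.c i (t.eval y)
  | s i j t => MSA.s i j (t.eval y)

/-- Renaming of the indices of the operations. -/
def map {I J G : Type u} (e : I → J) : Term I G → Term J G
  | var g => var g
  | bot => bot
  | top => top
  | sup t r => sup (t.map e) (r.map e)
  | inf t r => inf (t.map e) (r.map e)
  | compl t => compl (t.map e)
  | box t => box (t.map e)
  | c i t => c (e i) (t.map e)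
  | s i j t => s (e i) (e j) (t.map e)

end Term

section Free

variable {I G : Type u} (Λ : Set ModalAxiom) (ρ : G → Set I)

/-- The congruence `Cr^ρ L` of the class `L` of dimension complemented algebras that validate
`Λ`. It is the intersection of all congruences `θ` of the absolutely free algebra such that the
quotient by `θ` embeds in a member of `L` and `c_k g / θ = g / θ` for all generators `g` and all
`k ∉ ρ g`. These `θ` are the kernels of the homomorphisms to members of `L` that send every
generator `g` to an element `x` with `Δ x ⊆ ρ g`. -/
def Cr (t r : Term I G) : Prop :=
  ∀ (B : Type u) [ModalAlgebra B] [MSA I B], InClass I B Λ →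
    ∀ y : G → B, (∀ g, dimSet I (y g) ⊆ ρ g) → t.eval y = r.eval y

/-- `Cr` as a setoid. -/
def crSetoid : Setoid (Term I G) where
  r := Cr Λ ρ
  iseqv :=
    { refl := fun _ _ _ _ _ _ _ => rfl
      symm := fun h B _ _ hB y hy => (h B hB y hy).symm
      trans := fun h h' B _ _ hB y hy => (h B hB y hy).trans (h' B hB y hy) }

/-- The dimension restricted free algebra `Fr^ρ L` with generators `G`. -/
def Fr : Type u := Quotient (crSetoid Λ ρ)

variable {Λ ρ}

/-- The class of a term in the dimension restricted free algebra. -/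
def Fr.mk (t : Term I G) : Fr Λ ρ := Quotient.mk (crSetoid Λ ρ) t

theorem Fr.ind {p : Fr Λ ρ → Prop} (h : ∀ t, p (Fr.mk t)) : ∀ x, p x :=
  fun x => Quotient.ind h x

theorem Fr.sound {t r : Term I G} (h : Cr Λ ρ t r) : (Fr.mk t : Fr Λ ρ) = Fr.mk r :=
  Quotient.sound h

theorem Fr.exact {t r : Term I G} (h : (Fr.mk t : Fr Λ ρ) = Fr.mk r) : Cr Λ ρ t r :=
  Quotient.exact h

/-- The unary operation on the free algebra induced by an operation on terms. -/
def Fr.lift₁ (f : Term I G → Term I G) (hf : ∀ t t', Cr Λ ρ t t' → Cr Λ ρ (f t) (f t')) :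
    Fr Λ ρ → Fr Λ ρ :=
  Quotient.lift (fun t => Fr.mk (f t)) fun t t' h => Fr.sound (hf t t' h)

/-- The binary operation on the free algebra induced by an operation on terms. -/
def Fr.lift₂ (f : Term I G → Term I G → Term I G)
    (hf : ∀ t t' r r', Cr Λ ρ t t' → Cr Λ ρ r r' → Cr Λ ρ (f t r) (f t' r')) :
    Fr Λ ρ → Fr Λ ρ → Fr Λ ρ :=
  Quotient.lift₂ (fun t r => Fr.mk (f t r)) fun t r t' r' h h' => Fr.sound (hf t t' r r' h h')

instance : Max (Fr Λ ρ) where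
  max := Fr.lift₂ Term.sup fun t t' r r' h h' B _ _ hB y hy => by
    simp only [Term.eval, h B hB y hy, h' B hB y hy]

instance : Min (Fr Λ ρ) where
  min := Fr.lift₂ Term.inf fun t t' r r' h h' B _ _ hB y hy => by
    simp only [Term.eval, h B hB y hy, h' B hB y hy]

instance : Compl (Fr Λ ρ) where
  compl := Fr.lift₁ Term.compl fun t t' h B _ _ hB y hy => by
    simp only [Term.eval, h B hB y hy]

instance : Top (Fr Λ ρ) := ⟨Fr.mk Term.top⟩

instance : Bot (Fr Λ ρ) := ⟨Fr.mk Term.bot⟩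

instance : LE (Fr Λ ρ) := ⟨fun a b => a ⊔ b = b⟩

/-- `□` on the free algebra. -/
def Fr.box : Fr Λ ρ → Fr Λ ρ :=
  Fr.lift₁ Term.box fun t t' h B _ _ hB y hy => by
    simp only [Term.eval, h B hB y hy]

/-- `c_i` on the free algebra. -/
def Fr.c (i : I) : Fr Λ ρ → Fr Λ ρ :=
  Fr.lift₁ (Term.c i) fun t t' h B _ _ hB y hy => by
    simp only [Term.eval, h B hB y hy]

/-- `s_i^j` on the free algebra. -/
def Fr.s (i j : I) : Fr Λ ρ → Fr Λ ρ :=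
  Fr.lift₁ (Term.s i j) fun t t' h B _ _ hB y hy => by
    simp only [Term.eval, h B hB y hy]

theorem Fr.mk_le {t r : Term I G} :
    (Fr.mk t : Fr Λ ρ) ≤ Fr.mk r ↔
      ∀ (B : Type u) [ModalAlgebra B] [MSA I B], InClass I B Λ →
        ∀ y : G → B, (∀ g, dimSet I (y g) ⊆ ρ g) → t.eval y ≤ r.eval y := by
  constructor
  · intro h B _ _ hB y hy
    exact sup_eq_right.mp (Fr.exact (t := Term.sup t r) h B hB y hy)
  · intro h
    exact Fr.sound (t := Term.sup t r) fun B _ _ hB y hy => sup_eq_right.mpr (h B hB y hy)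

instance : ModalAlgebra (Fr Λ ρ) where
  le_refl := Fr.ind fun t => Fr.mk_le.mpr fun _ _ _ _ _ _ => le_rfl
  le_trans := Fr.ind fun t => Fr.ind fun r => Fr.ind fun q => fun h h' =>
    Fr.mk_le.mpr fun B _ _ hB y hy => (Fr.mk_le.mp h B hB y hy).trans (Fr.mk_le.mp h' B hB y hy)
  le_antisymm := Fr.ind fun t => Fr.ind fun r => fun h h' => Fr.sound fun B _ _ hB y hy =>
    (Fr.mk_le.mp h B hB y hy).antisymm (Fr.mk_le.mp h' B hB y hy)
  sup := (· ⊔ ·)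
  inf := (· ⊓ ·)
  le_sup_left := Fr.ind fun t => Fr.ind fun r =>
    Fr.mk_le (r := Term.sup t r).mpr fun _ _ _ _ _ _ => le_sup_left
  le_sup_right := Fr.ind fun t => Fr.ind fun r =>
    Fr.mk_le (r := Term.sup t r).mpr fun _ _ _ _ _ _ => le_sup_right
  sup_le := Fr.ind fun t => Fr.ind fun r => Fr.ind fun q => fun h h' =>
    Fr.mk_le (t := Term.sup t r).mpr fun B _ _ hB y hy =>
      sup_le (Fr.mk_le.mp h B hB y hy) (Fr.mk_le.mp h' B hB y hy)
  inf_le_left := Fr.ind fun t => Fr.ind fun r =>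
    Fr.mk_le (t := Term.inf t r).mpr fun _ _ _ _ _ _ => inf_le_left
  inf_le_right := Fr.ind fun t => Fr.ind fun r =>
    Fr.mk_le (t := Term.inf t r).mpr fun _ _ _ _ _ _ => inf_le_right
  le_inf := Fr.ind fun t => Fr.ind fun r => Fr.ind fun q => fun h h' =>
    Fr.mk_le (r := Term.inf r q).mpr fun B _ _ hB y hy =>
      le_inf (Fr.mk_le.mp h B hB y hy) (Fr.mk_le.mp h' B hB y hy)
  le_sup_inf := Fr.ind fun t => Fr.ind fun r => Fr.ind fun q =>
    Fr.mk_le (t := Term.inf (Term.sup t r) (Term.sup t q))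
      (r := Term.sup t (Term.inf r q)).mpr fun _ _ _ _ _ _ => le_sup_inf
  inf_compl_le_bot := Fr.ind fun t =>
    Fr.mk_le (t := Term.inf t (Term.compl t)) (r := Term.bot).mpr
      fun _ _ _ _ _ _ => BooleanAlgebra.inf_compl_le_bot _
  top_le_sup_compl := Fr.ind fun t =>
    Fr.mk_le (t := Term.top) (r := Term.sup t (Term.compl t)).mpr
      fun _ _ _ _ _ _ => BooleanAlgebra.top_le_sup_compl _
  le_top := Fr.ind fun t => Fr.mk_le (r := Term.top).mpr fun _ _ _ _ _ _ => le_top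
  bot_le := Fr.ind fun t => Fr.mk_le (t := Term.bot).mpr fun _ _ _ _ _ _ => bot_le
  box := Fr.box
  box_top := Fr.sound (t := Term.box Term.top) (r := Term.top)
    fun _ _ _ _ _ _ => ModalAlgebra.box_top
  box_imp := Fr.ind fun t => Fr.ind fun r =>
    Fr.mk_le (t := Term.box (Term.sup (Term.compl t) r))
      (r := Term.sup (Term.compl (Term.box t)) (Term.box r)).mpr
      fun _ _ _ _ _ _ => ModalAlgebra.box_imp _ _

instance : MSA I (Fr Λ ρ) where
  c := Fr.c
  s := Fr.s
  c_bot j := Fr.sound (t := .c j .bot) (r := .bot) fun _ _ _ _ _ _ => MSA.c_bot j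
  le_c i := Fr.ind fun t => Fr.mk_le (r := .c i t).mpr fun _ _ _ _ _ _ => MSA.le_c i _
  c_inf_c i := Fr.ind fun t => Fr.ind fun r =>
    Fr.sound (t := .c i (.inf t (.c i r))) (r := .inf (.c i t) (.c i r))
      fun _ _ _ _ _ _ => MSA.c_inf_c i _ _
  c_sup i := Fr.ind fun t => Fr.ind fun r =>
    Fr.sound (t := .c i (.sup t r)) (r := .sup (.c i t) (.c i r))
      fun _ _ _ _ _ _ => MSA.c_sup i _ _
  c_comm i j := Fr.ind fun t =>
    Fr.sound (t := .c i (.c j t)) (r := .c j (.c i t)) fun _ _ _ _ _ _ => MSA.c_comm i j _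
  s_self i := Fr.ind fun t =>
    Fr.sound (t := .s i i t) (r := t) fun _ _ _ _ _ _ => MSA.s_self i _
  s_sup i j := Fr.ind fun t => Fr.ind fun r =>
    Fr.sound (t := .s i j (.sup t r)) (r := .sup (.s i j t) (.s i j r))
      fun _ _ _ _ _ _ => MSA.s_sup i j _ _
  s_inf i j := Fr.ind fun t => Fr.ind fun r =>
    Fr.sound (t := .s i j (.inf t r)) (r := .inf (.s i j t) (.s i j r))
      fun _ _ _ _ _ _ => MSA.s_inf i j _ _
  s_compl i j := Fr.ind fun t =>
    Fr.sound (t := .s i j (.compl t)) (r := .compl (.s i j t))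
      fun _ _ _ _ _ _ => MSA.s_compl i j _
  s_bot i j := Fr.sound (t := .s i j .bot) (r := .bot) fun _ _ _ _ _ _ => MSA.s_bot i j
  s_top i j := Fr.sound (t := .s i j .top) (r := .top) fun _ _ _ _ _ _ => MSA.s_top i j
  s_box i j := Fr.ind fun t =>
    Fr.sound (t := .s i j (.box t)) (r := .box (.s i j t))
      fun _ _ _ _ _ _ => MSA.s_box i j _
  s_c_same i j := Fr.ind fun t =>
    Fr.sound (t := .s j i (.c i t)) (r := .c i t) fun _ _ _ _ _ _ => MSA.s_c_same i j _
  c_s_same i j := Fr.ind fun t => fun h =>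
    Fr.sound (t := .c i (.s j i t)) (r := .s j i t) fun _ _ _ _ _ _ => MSA.c_s_same i j _ h
  s_c_comm i j k := Fr.ind fun t => fun h h' =>
    Fr.sound (t := .s j i (.c k t)) (r := .c k (.s j i t))
      fun _ _ _ _ _ _ => MSA.s_c_comm i j k _ h h'
  c_s_swap i j := Fr.ind fun t =>
    Fr.sound (t := .c i (.s i j t)) (r := .c j (.s j i t))
      fun _ _ _ _ _ _ => MSA.c_s_swap i j _
  s_comm i j k l := Fr.ind fun t => fun h₁ h₂ h₃ h₄ h₅ h₆ =>
    Fr.sound (t := .s i j (.s k l t)) (r := .s k l (.s i j t))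
      fun _ _ _ _ _ _ => MSA.s_comm i j k l _ h₁ h₂ h₃ h₄ h₅ h₆
  s_s i j l := Fr.ind fun t =>
    Fr.sound (t := .s i l (.s l j t)) (r := .s i l (.s i j t))
      fun _ _ _ _ _ _ => MSA.s_s i j l _

end Free

/-! The canonical Kripke system. -/

/-- A Kripke system: worlds, accessibility relation, and non-empty domains, subsets of a set `X`,
that increase along the accessibility relation. -/
structure KripkeSystem (X : Type u) where
  World : Type v
  Rel : World → World → Prop
  Dom : World → Set X
  dom_nonempty : ∀ w, (Dom w).Nonempty
  dom_mono : ∀ w w', Rel w w' → Dom w ⊆ Dom w'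

section Canonical

open Ordinal

variable {α β : Ordinal.{u}} (Λ : Set ModalAxiom) (ρ : Set.Iio β → Set (Set.Iio α))

/-- `ρ`, seen as a function to subsets of the ordinal `γ`. -/
def extendRestr (γ : Ordinal.{u}) (η : Set.Iio β) : Set (Set.Iio γ) :=
  {j | ∃ i ∈ ρ η, i.1 = j.1}

/-- `Fr_β^ρ L_γ`: the `ρ`-dimension restricted free algebra of dimension `γ` with `β` generators,
over the class of dimension complemented algebras that validate `Λ`. -/
abbrev FrDim (γ : Ordinal.{u}) : Type (u + 1) := Fr (I := Set.Iio γ) Λ (extendRestr ρ γ)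

variable {Λ ρ}

/-- The image of a set `X ⊆ Fr_β^ρ L_γ` in `Fr_β^ρ L_δ`, where `γ ≤ δ`, under the canonical
embedding, which sends generators to generators and keeps `□`, `c_i`, `s_i^j` for `i, j < γ`. -/
def push {γ δ : Ordinal.{u}} (h : γ ≤ δ) (X : Set (FrDim Λ ρ γ)) : Set (FrDim Λ ρ δ) :=
  {y | ∃ t : Term (Set.Iio γ) (Set.Iio β), Fr.mk t ∈ X ∧
    y = Fr.mk (t.map (Set.inclusion (Set.Iio_subset_Iio h)))}

/-- The dimension `α + nω` of the algebra `B_n`. -/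
def dimN (α : Ordinal.{u}) (n : ℕ) : Ordinal.{u} := α + ω * n

theorem le_dimN (α : Ordinal.{u}) (n : ℕ) : α ≤ dimN α n := le_self_add

theorem dimN_mono (α : Ordinal.{u}) {n m : ℕ} (h : n ≤ m) : dimN α n ≤ dimN α m := by
  unfold dimN
  gcongr

theorem dimN_le (α : Ordinal.{u}) (n : ℕ) : dimN α n ≤ α + ω * ω := by
  unfold dimN
  gcongr
  exact (natCast_lt_omega0 n).le

variable (X₁ X₂ : Set (FrDim Λ ρ α))

/-- `Sg^{B_n} X` for `X ⊆ A`, as a subset of `B_n = Fr_β^ρ L_{α + nω}`. -/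
def sgN (n : ℕ) (X : Set (FrDim Λ ρ α)) : Set (FrDim Λ ρ (dimN α n)) :=
  sg (Set.Iio (dimN α n)) (push (le_dimN α n) X)

/-- A pair `(T, F)` of subsets of `B_∞ = Fr_β^ρ L_{α + ω·ω}` is `(X₁, X₂, B_n)`-saturated, where
`B_n` is identified with its image in `B_∞`. -/
def SaturatedAt (n : ℕ) (w : Set (FrDim Λ ρ (α + ω * ω)) × Set (FrDim Λ ρ (α + ω * ω))) : Prop :=
  ∃ T F : Set (FrDim Λ ρ (dimN α n)),
    Saturated (Set.Iio (dimN α n)) (push (le_dimN α n) X₁) (push (le_dimN α n) X₂) T F ∧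
    w.1 = push (dimN_le α n) T ∧ w.2 = push (dimN_le α n) F

/-- The worlds: the pairs that are `(X₁, X₂, B_n)`-saturated for some `n`. -/
def World : Type (u + 1) :=
  {w : Set (FrDim Λ ρ (α + ω * ω)) × Set (FrDim Λ ρ (α + ω * ω)) // ∃ n, SaturatedAt X₁ X₂ n w}

variable {X₁ X₂}

/-- The least `n` such that the world is `(X₁, X₂, B_n)`-saturated. -/
noncomputable def World.level (w : World X₁ X₂) : ℕ := sInf {n | SaturatedAt X₁ X₂ n w.1}

/-- The accessibility relation. -/
def World.Acc (w w' : World X₁ X₂) : Prop :=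
  w.level ≤ w'.level ∧
  (∀ a ∈ push (dimN_le α w.level) (sgN w.level X₁), box a ∈ w.1.1 → a ∈ w'.1.1) ∧
  (∀ b ∈ push (dimN_le α w.level) (sgN w.level X₂), dia b ∈ w.1.2 → b ∈ w'.1.2)

variable (X₁ X₂)

/-- The canonical Kripke system, with domains `D_w = α + nω`, where `n` is the level of `w`. -/
noncomputable def canonicalKripke (hα : ω ≤ α) : KripkeSystem.{u + 1, u + 1} Ordinal.{u} where
  World := World X₁ X₂
  Rel := World.Acc
  Dom w := Set.Iio (dimN α w.level)
  dom_nonempty _ := ⟨0, (omega0_pos.trans_le hα).trans_le (le_dimN α _)⟩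
  dom_mono _ _ h := Set.Iio_subset_Iio (dimN_mono α h.1)

end Canonical

end QML

/-! Reflexivity and transitivity concern single inequalities. At a world of level `n` the theory is
an up-set and the cotheory a down-set of its subalgebra of `B_n`, so `□a ≤ a`, `b ≤ ◇b`,
respectively `□a ≤ □□a`, `◇◇b ≤ ◇b` in `B_n` suffice. Only `A` is assumed to satisfy the axiom, so
it has to be transferred to `B_n`. An equation involves finitely many indices and generators, and
infinitely many indices of `A` lie outside the restrictions of these generators. Hence some
bijection between the index sets agrees with the inclusion wherever it matters
(`Extends.exists_equiv`), and bijections preserve equations (`Cr.map_equiv`).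

For seriality let `(T, F)` have level `n`, and consider `{a : □a ∈ T}` and `{u : -□u ∈ F}` inside
`B_{n+1}`. No common element `c` of the two generated subalgebras separates them: by renaming, a
separator can be moved down to `B_n` (`Extends.exists_separator`), where `□c ∈ T`, while `□c ≤ ◇c ∈
F` by D. The `ω` new indices are fresh for both filters, so a Henkin construction, as in proofs of
Craig interpolation, extends them to a saturated pair over `B_{n+1}` (`exists_saturated`). It treats
countably many requirements one by one.

The level is a minimum, so the new pair might have level below `n`. But a pair saturated at two
levels forces all elements of `X₁` and `X₂` to have empty dimension set
(`dimSet_eq_empty_of_saturatedAt`); then the generated subalgebras do not grow with the dimension,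
and every world has level `0`. -/

namespace QML

/-! ### Calculus of `□`, cylindrifications and substitutions -/

section Calculus

variable {I : Type u} {A : Type v} [ModalAlgebra A]

theorem compl_sup_eq_top_iff {x y : A} : xᶜ ⊔ y = ⊤ ↔ x ≤ y := by
  rw [← himp_eq_top_iff, himp_eq, sup_comm]

theorem box_le_box {x y : A} (h : x ≤ y) : box x ≤ box y := by
  have h2 := ModalAlgebra.box_imp x y
  rw [compl_sup_eq_top_iff.mpr h, ModalAlgebra.box_top, top_le_iff] at h2
  exact compl_sup_eq_top_iff.mp h2

theorem box_inf_box_le (x y : A) : box x ⊓ box y ≤ box (x ⊓ y) := by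
  have h : x ≤ yᶜ ⊔ (x ⊓ y) := by
    rw [sup_inf_left, compl_sup_eq_top, inf_top_eq]
    exact le_sup_right
  have h2 := (box_le_box h).trans (ModalAlgebra.box_imp y (x ⊓ y))
  calc box x ⊓ box y ≤ ((box y)ᶜ ⊔ box (x ⊓ y)) ⊓ box y := inf_le_inf_right _ h2
    _ ≤ box (x ⊓ y) := by
      rw [inf_sup_right, compl_inf_eq_bot, bot_sup_eq]
      exact inf_le_left

theorem dia_le_dia {x y : A} (h : x ≤ y) : dia x ≤ dia y :=
  compl_le_compl (box_le_box (compl_le_compl h))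

theorem dia_compl (x : A) : dia xᶜ = (box x)ᶜ := by
  rw [dia, compl_compl]

theorem box_le_dia (hD : dia (⊤ : A) = ⊤) (x : A) : box x ≤ dia x := by
  have h := box_inf_box_le x xᶜ
  rw [dia, compl_eq_top, compl_top] at hD
  rw [inf_compl_eq_bot, hD, le_bot_iff] at h
  exact le_compl_iff_disjoint_right.mpr (disjoint_iff.mpr h)

theorem box_le_self (hT : ∀ p : A, (box p)ᶜ ⊔ p = ⊤) (x : A) : box x ≤ x :=
  compl_sup_eq_top_iff.mp (hT x)

theorem box_le_box_box (h4 : ∀ p : A, (box p)ᶜ ⊔ box (box p) = ⊤) (x : A) :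
    box x ≤ box (box x) :=
  compl_sup_eq_top_iff.mp (h4 x)

theorem le_dia_self (hT : ∀ p : A, (box p)ᶜ ⊔ p = ⊤) (x : A) : x ≤ dia x :=
  le_compl_comm.mp (box_le_self hT xᶜ)

theorem dia_dia_le (h4 : ∀ p : A, (box p)ᶜ ⊔ box (box p) = ⊤) (x : A) :
    dia (dia x) ≤ dia x := by
  rw [dia, dia, compl_compl]
  exact compl_le_compl (box_le_box_box h4 _)

variable [MSA I A]

theorem c_eq_of_notMem_dimSet {i : I} {x : A} (h : i ∉ dimSet I x) : MSA.c i x = x :=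
  not_not.mp h

theorem notMem_dimSet_of_c_eq {i : I} {x : A} (h : MSA.c i x = x) : i ∉ dimSet I x :=
  not_not.mpr h

theorem c_mono (i : I) {x y : A} (h : x ≤ y) : MSA.c i x ≤ MSA.c i y := by
  rw [← sup_eq_right, ← MSA.c_sup, sup_eq_right.mpr h]

theorem c_inf_eq {i : I} {x y : A} (hx : MSA.c i x = x) (hy : MSA.c i y = y) :
    MSA.c i (x ⊓ y) = x ⊓ y := by
  conv_lhs => rw [← hy]
  rw [MSA.c_inf_c, hx, hy]

theorem c_compl_eq {i : I} {x : A} (h : MSA.c i x = x) : MSA.c i xᶜ = xᶜ := by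
  have h1 := MSA.c_inf_c i xᶜ x
  rw [h, compl_inf_eq_bot, MSA.c_bot] at h1
  exact le_antisymm (le_compl_iff_disjoint_right.mpr (disjoint_iff.mpr h1.symm)) (MSA.le_c i _)

theorem c_compl_eq_iff {i : I} {x : A} : MSA.c i xᶜ = xᶜ ↔ MSA.c i x = x :=
  ⟨fun h => by simpa using c_compl_eq h, c_compl_eq⟩

theorem s_eq_self {i : I} (j : I) {x : A} (h : MSA.c i x = x) : MSA.s j i x = x := by
  conv_lhs => rw [← h]
  rw [MSA.s_c_same, h]

/-- No axiom relates `c i` to `□` directly. A second index `j` helps: `x = s_j^i x` gives `□x =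
s_j^i □x`, and `c i` fixes everything of the form `s_j^i y`. -/
theorem c_box_eq {i j : I} (hij : i ≠ j) {x : A} (h : MSA.c i x = x) :
    MSA.c i (box x) = box x := by
  have h1 := MSA.c_s_same i j (box x) hij
  rwa [MSA.s_box, s_eq_self j h] at h1

/-- Renaming of a bound variable. This is what makes a fresh index a Henkin witness. -/
theorem c_s_fresh {j : I} (k : I) {x : A} (h : MSA.c j x = x) :
    MSA.c j (MSA.s j k x) = MSA.c k x := by
  rw [MSA.c_s_swap, s_eq_self k h]

/-- Substituting back, `s_i^j s_j^i x = s_i^j x = x`. If `s_j^i x` did not depend on `j`, the left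
side would be `s_j^i x`, which `c i` fixes. -/
theorem c_eq_of_c_s_eq {i j : I} (hij : i ≠ j) {x : A} (hj : MSA.c j x = x)
    (h : MSA.c j (MSA.s j i x) = MSA.s j i x) : MSA.c i x = x := by
  have h1 : MSA.s i j (MSA.s j i x) = MSA.s j i x := s_eq_self i h
  rw [MSA.s_s, MSA.s_self, s_eq_self i hj] at h1
  rw [h1, MSA.c_s_same _ _ _ hij]

end Calculus

/-! ### Theories as filters, cotheories as ideals -/

section Theories

variable {I : Type u} {A : Type v} [ModalAlgebra A] [MSA I A]

theorem sg_compl_mem_iff {X : Set A} {x : A} : xᶜ ∈ sg I X ↔ x ∈ sg I X :=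
  ⟨fun h => compl_compl x ▸ Sg.compl _ h, Sg.compl x⟩

theorem sg_dia_mem {X : Set A} {x : A} (h : x ∈ sg I X) : dia x ∈ sg I X :=
  (h.compl.box).compl

theorem IsTheory.mem_of_le {S T : Set A} (h : IsTheory S T) {a b : A} (ha : a ∈ T)
    (hab : a ≤ b) (hb : b ∈ S) : b ∈ T :=
  h.2 b hb ⟨{a}, {b}, by simpa using ha, by simp, by simpa using hab⟩

theorem IsTheory.top_mem {S T : Set A} (h : IsTheory S T) (hS : ⊤ ∈ S) : ⊤ ∈ T :=
  h.2 _ hS ⟨∅, {⊤}, by simp, by simp, by simp⟩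

theorem IsTheory.inf_mem {S T : Set A} (h : IsTheory S T) {a b : A} (ha : a ∈ T)
    (hb : b ∈ T) (hS : a ⊓ b ∈ S) : a ⊓ b ∈ T := by
  classical
  exact h.2 _ hS ⟨{a, b}, {a ⊓ b}, by simp [Set.insert_subset_iff, ha, hb], by simp, by simp⟩

theorem isTheory_of_filter {S T : Set A} (hTS : T ⊆ S) (htop : ⊤ ∈ T)
    (hinf : ∀ a ∈ T, ∀ b ∈ T, a ⊓ b ∈ T) (hle : ∀ a ∈ T, ∀ b ∈ S, a ≤ b → b ∈ T) :
    IsTheory S T := by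
  refine ⟨hTS, fun a ha ⟨s, t, hs, ht, hst⟩ => hle (s.inf id) ?_ a ha (hst.trans ?_)⟩
  · exact Finset.inf_induction htop hinf fun b hb => hs hb
  · exact Finset.sup_le fun b hb => (ht hb).le

theorem IsCotheory.mem_of_le {S F : Set A} (h : IsCotheory S F) {a b : A} (ha : a ∈ F)
    (hab : b ≤ a) (hb : b ∈ S) : b ∈ F :=
  h.2 b hb ⟨{b}, {a}, by simp, by simpa using ha, by simpa using hab⟩

theorem IsCotheory.bot_mem {S F : Set A} (h : IsCotheory S F) (hS : ⊥ ∈ S) : ⊥ ∈ F :=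
  h.2 _ hS ⟨{⊥}, ∅, by simp, by simp, by simp⟩

theorem IsCotheory.sup_mem {S F : Set A} (h : IsCotheory S F) {a b : A} (ha : a ∈ F)
    (hb : b ∈ F) (hS : a ⊔ b ∈ S) : a ⊔ b ∈ F := by
  classical
  exact h.2 _ hS ⟨{a ⊔ b}, {a, b}, by simp, by simp [Set.insert_subset_iff, ha, hb], by simp⟩

theorem isCotheory_of_ideal {S F : Set A} (hFS : F ⊆ S) (hbot : ⊥ ∈ F)
    (hsup : ∀ a ∈ F, ∀ b ∈ F, a ⊔ b ∈ F) (hle : ∀ a ∈ F, ∀ b ∈ S, b ≤ a → b ∈ F) :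
    IsCotheory S F := by
  refine ⟨hFS, fun a ha ⟨s, t, hs, ht, hst⟩ => hle (t.sup id) ?_ a ha (le_trans ?_ hst)⟩
  · exact Finset.sup_induction hbot hsup fun b hb => ht hb
  · exact Finset.le_inf fun b hb => (hs hb).ge

end Theories

/-! ### Henkin construction of saturated pairs -/

section Henkin

variable {I : Type u} {A : Type v} [ModalAlgebra A] [MSA I A]

/-- No element of `S` separates the filter generated by `T` and `p` from the one generated by
`U` and `q`. -/
def Inseparable (S T U : Set A) (p q : A) : Prop :=
  ∀ t ∈ T, ∀ u ∈ U, ∀ c ∈ S, t ⊓ p ≤ c → u ⊓ q ≤ cᶜ → False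

theorem Inseparable.symm {S T U : Set A} (hS : ∀ x ∈ S, xᶜ ∈ S) {p q : A}
    (h : Inseparable S T U p q) : Inseparable S U T q p :=
  fun u hu t ht c hc h1 h2 => h t ht u hu cᶜ (hS c hc) h2 (by rwa [compl_compl])

theorem Inseparable.anti {S T U : Set A} {p q p' q' : A} (hp : p' ≤ p) (hq : q' ≤ q)
    (h : Inseparable S T U p' q') : Inseparable S T U p q :=
  fun t ht u hu c hc h1 h2 => h t ht u hu c hc ((inf_le_inf_left t hp).trans h1)
    ((inf_le_inf_left u hq).trans h2)

/-- A fresh index is a witness for `c_k a` that does not destroy inseparability. -/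
theorem Inseparable.witness {S T U : Set A} (hSc : ∀ (i : I), ∀ x ∈ S, MSA.c i x ∈ S)
    {p q a : A} {j k : I} (hT : ∀ t ∈ T, j ∉ dimSet I t) (hU : ∀ u ∈ U, j ∉ dimSet I u)
    (hp : j ∉ dimSet I p) (hq : j ∉ dimSet I q) (ha : j ∉ dimSet I a)
    (h : Inseparable S T U (p ⊓ MSA.c k a) q) : Inseparable S T U (p ⊓ MSA.s j k a) q := by
  intro t ht u hu c hc h1 h2
  -- If `c` separates once the witness is added, then `c_j c` separated before: `c_j` turns `t ⊓ p ⊓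
  -- s_j^k a` into `t ⊓ p ⊓ c_k a` and fixes `-(u ⊓ q)`.
  refine h t ht u hu (MSA.c j c) (hSc j c hc) ?_ ?_
  · have h3 : MSA.c j (t ⊓ p) = t ⊓ p :=
      c_inf_eq (c_eq_of_notMem_dimSet (hT t ht)) (c_eq_of_notMem_dimSet hp)
    have h4 := MSA.c_inf_c j (MSA.s j k a) (t ⊓ p)
    rw [h3, c_s_fresh k (c_eq_of_notMem_dimSet ha), inf_comm, inf_comm (MSA.c k a),
      inf_assoc, inf_assoc] at h4
    rw [← h4]
    exact c_mono j h1
  · have h3 : MSA.c j (u ⊓ q)ᶜ = (u ⊓ q)ᶜ := c_compl_eq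
      (c_inf_eq (c_eq_of_notMem_dimSet (hU u hu)) (c_eq_of_notMem_dimSet hq))
    have h4 := c_mono j (le_compl_comm.mp h2)
    rw [h3] at h4
    exact le_compl_comm.mp h4

/-- The requirement that `c_k a`, if consistent, has a witness. -/
def Decided (S T U : Set A) (k : I) (a p q : A) : Prop :=
  (∃ j : I, j ∉ dimSet I a ∧ p ≤ MSA.s j k a) ∨ ¬ Inseparable S T U (p ⊓ MSA.c k a) q

/-- A requirement once met stays met as `p` and `q` shrink, so each pair `(k, a)` needs to be
treated only once. -/
theorem Decided.anti {S T U : Set A} {k : I} {a p q p' q' : A} (hp : p' ≤ p) (hq : q' ≤ q)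
    (h : Decided S T U k a p q) : Decided S T U k a p' q' := by
  rcases h with ⟨j, hj, h⟩ | h
  · exact Or.inl ⟨j, hj, hp.trans h⟩
  · exact Or.inr fun h' => h (h'.anti (inf_le_inf_right _ hp) hq)

/-- One Henkin step. If `p ⊓ c_k a` is still inseparable from `q`, then `s_j^k a` is adjoined for
some `j ∈ J` on which `p`, `q`, `a` do not depend; `J` is infinite and only finitely many of its
members are excluded. -/
theorem Inseparable.exists_decided {S T U Y : Set A}
    (hSc : ∀ (i : I), ∀ x ∈ S, MSA.c i x ∈ S)
    {J : Set I} (hJ : J.Infinite) (hfin : ∀ x : A, (dimSet I x ∩ J).Finite)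
    (hT : ∀ t ∈ T, ∀ j ∈ J, j ∉ dimSet I t) (hU : ∀ u ∈ U, ∀ j ∈ J, j ∉ dimSet I u)
    {p q : A} (hp : p ∈ sg I Y) (h : Inseparable S T U p q) (k : I) (a : A) :
    ∃ p' ≤ p, p' ∈ sg I Y ∧ Inseparable S T U p' q ∧
      (a ∈ sg I Y → Decided S T U k a p' q) := by
  by_cases haY : a ∈ sg I Y
  swap
  · exact ⟨p, le_rfl, hp, h, fun h => absurd h haY⟩
  by_cases hd : Inseparable S T U (p ⊓ MSA.c k a) q
  swap
  · exact ⟨p, le_rfl, hp, h, fun _ => Or.inr hd⟩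
  obtain ⟨j, hjJ, hj⟩ := (hJ.sdiff (((hfin p).union (hfin q)).union (hfin a))).nonempty
  simp only [Set.mem_union, Set.mem_inter_iff, hjJ, and_true, not_or] at hj
  exact ⟨p ⊓ MSA.s j k a, inf_le_left, hp.inf _ _ (haY.s _ _ _),
    hd.witness hSc (fun t ht => hT t ht j hjJ) (fun u hu => hU u hu j hjJ) hj.1.1 hj.1.2 hj.2,
    fun _ => Or.inl ⟨j, hj.2, inf_le_right⟩⟩

/-- The filter of the subalgebra `S` generated by `T` and a sequence of elements. -/
def limitFilter (S T : Set A) (p : ℕ → A) : Set A :=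
  {a | a ∈ S ∧ ∃ n, ∃ t ∈ T, t ⊓ p n ≤ a}

theorem isTheory_limitFilter {X T : Set A} {p : ℕ → A} (hp : Antitone p)
    (hT : ⊤ ∈ T) (hinf : ∀ a ∈ T, ∀ b ∈ T, a ⊓ b ∈ T) :
    IsTheory (sg I X) (limitFilter (sg I X) T p) := by
  refine isTheory_of_filter (fun a ha => ha.1) ⟨Sg.top, 0, ⊤, hT, le_top⟩ ?_ ?_
  · rintro a ⟨ha, n, t, ht, h⟩ b ⟨hb, m, t', ht', h'⟩
    refine ⟨ha.inf _ _ hb, max n m, t ⊓ t', hinf t ht t' ht', le_inf ?_ ?_⟩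
    · exact (inf_le_inf inf_le_left (hp (le_max_left n m))).trans h
    · exact (inf_le_inf inf_le_right (hp (le_max_right n m))).trans h'
  · rintro a ⟨ha, n, t, ht, h⟩ b hb hab
    exact ⟨hb, n, t, ht, h.trans hab⟩

/-- Along an enumeration of `I × A`, each stage treats the left side and then the right side. -/
theorem exists_decided_sequence [Countable I] [Countable A] {X₁ X₂ T U : Set A}
    {J : Set I} (hJ : J.Infinite) (hfin : ∀ x : A, (dimSet I x ∩ J).Finite)
    (hTJ : ∀ t ∈ T, ∀ j ∈ J, j ∉ dimSet I t) (hUJ : ∀ u ∈ U, ∀ j ∈ J, j ∉ dimSet I u)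
    (h : Inseparable (sg I X₁ ∩ sg I X₂) T U ⊤ ⊤) :
    ∃ p q : ℕ → A, Antitone p ∧ Antitone q ∧
      (∀ n, p n ∈ sg I X₁ ∧ q n ∈ sg I X₂ ∧
        Inseparable (sg I X₁ ∩ sg I X₂) T U (p n) (q n)) ∧
      ∀ (k : I) (a : A), ∃ n,
        (a ∈ sg I X₁ → Decided (sg I X₁ ∩ sg I X₂) T U k a (p n) (q n)) ∧
        (a ∈ sg I X₂ → Decided (sg I X₁ ∩ sg I X₂) U T k a (q n) (p n)) := by
  set S := sg I X₁ ∩ sg I X₂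
  have hSc : ∀ (i : I), ∀ x ∈ S, MSA.c i x ∈ S := fun i x hx => ⟨hx.1.c _ _, hx.2.c _ _⟩
  have hSn : ∀ x ∈ S, xᶜ ∈ S := fun x hx => ⟨hx.1.compl, hx.2.compl⟩
  let Good : A × A → Prop := fun z => z.1 ∈ sg I X₁ ∧ z.2 ∈ sg I X₂ ∧ Inseparable S T U z.1 z.2
  have step : ∀ (z : {z // Good z}) (r : I × A), ∃ z' : {z // Good z}, z'.1 ≤ z.1 ∧
      (r.2 ∈ sg I X₁ → Decided S T U r.1 r.2 z'.1.1 z'.1.2) ∧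
      (r.2 ∈ sg I X₂ → Decided S U T r.1 r.2 z'.1.2 z'.1.1) := by
    rintro ⟨⟨p, q⟩, hp, hq, hpq⟩ ⟨k, a⟩
    obtain ⟨p', hp', hp'X, hpq', hd⟩ := hpq.exists_decided hSc hJ hfin hTJ hUJ hp k a
    obtain ⟨q', hq', hq'X, hpq'', hd'⟩ :=
      (hpq'.symm hSn).exists_decided hSc hJ hfin hUJ hTJ hq k a
    exact ⟨⟨(p', q'), hp'X, hq'X, hpq''.symm hSn⟩, ⟨hp', hq'⟩,
      fun ha => (hd ha).anti le_rfl hq', hd'⟩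
  choose next hnext hd₁ hd₂ using step
  have : Nonempty (I × A) := ⟨hJ.nonempty.some, ⊤⟩
  obtain ⟨r, hr⟩ := exists_surjective_nat (I × A)
  let z : ℕ → {z // Good z} := fun n =>
    Nat.rec ⟨(⊤, ⊤), Sg.top, Sg.top, h⟩ (fun n z => next z (r n)) n
  have hz : Antitone fun n => (z n).1 := antitone_nat_of_succ_le fun n => hnext (z n) (r n)
  refine ⟨fun n => (z n).1.1, fun n => (z n).1.2, fun n m hnm => (hz hnm).1,
    fun n m hnm => (hz hnm).2, fun n => (z n).2, fun k a => ?_⟩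
  obtain ⟨n, hn⟩ := hr (k, a)
  obtain rfl : (r n).1 = k := by rw [hn]
  obtain rfl : (r n).2 = a := by rw [hn]
  exact ⟨n + 1, hd₁ (z n) (r n), hd₂ (z n) (r n)⟩

/-- Where `c_k a` cannot be added consistently, a separator `c` exists: `c_k a → c` enters the left
filter and `-c` the right one. -/
theorem Decided.mem_limitFilter {X S T U : Set A} {p q : ℕ → A} {k : I} {a : A} {n : ℕ}
    {X' : Set A} (hS : S = sg I X ∩ sg I X') (hT : ⊤ ∈ T) (ha : a ∈ sg I X)
    (h : Decided S T U k a (p n) (q n)) :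
    (∃ j, j ∉ dimSet I a ∧ MSA.s j k a ∈ limitFilter (sg I X) T p) ∨
      ∃ c ∈ S, (MSA.c k a)ᶜ ⊔ c ∈ limitFilter (sg I X) T p ∧
        cᶜ ∈ limitFilter (sg I X') U q := by
  subst hS
  rcases h with ⟨j, hj, h⟩ | h
  · exact Or.inl ⟨j, hj, ha.s _ _ _, n, ⊤, hT, inf_le_right.trans h⟩
  · simp only [Inseparable, not_forall] at h
    obtain ⟨t, ht, u, hu, c, hc, h1, h2, -⟩ := h
    refine Or.inr ⟨c, hc, ⟨Sg.sup _ _ (ha.c _ _).compl hc.1, n, t, ht, ?_⟩,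
      hc.2.compl, n, u, hu, h2⟩
    rw [← inf_assoc] at h1
    rw [sup_comm]
    simpa [sdiff_eq, himp_eq] using le_himp_iff.mpr h1

/-- Prime filters with witnesses, obtained from filters all of whose elements are decided. -/
theorem prime_and_witness {X T U S : Set A} (hS : S ⊆ sg I X)
    (hSs : ∀ x ∈ S, ∀ y ∈ S, x ⊔ y ∈ S) (hT : IsTheory (sg I X) T)
    (hTU : ∀ c ∈ S, c ∈ T → cᶜ ∉ U) (hU : ∀ a ∈ U, ∀ b ∈ U, a ⊓ b ∈ U)
    (hdc : ∀ a : A, ∃ k : I, k ∉ dimSet I a)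
    (hd : ∀ a ∈ sg I X, ∀ k : I, (∃ j, j ∉ dimSet I a ∧ MSA.s j k a ∈ T) ∨
      ∃ c ∈ S, (MSA.c k a)ᶜ ⊔ c ∈ T ∧ cᶜ ∈ U) :
    (∀ a ∈ sg I X, ∀ b ∈ sg I X, a ⊔ b ∈ T → a ∈ T ∨ b ∈ T) ∧
    ∀ a ∈ sg I X, ∀ k : I, MSA.c k a ∈ T → ∃ j : I, j ∉ dimSet I a ∧ MSA.s j k a ∈ T := by
  constructor
  · have key : ∀ a ∈ sg I X, a ∈ T ∨ ∃ c ∈ S, aᶜ ⊔ c ∈ T ∧ cᶜ ∈ U := by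
      intro a ha
      obtain ⟨k, hk⟩ := hdc a
      have hk := c_eq_of_notMem_dimSet hk
      have := hd a ha k
      simp only [s_eq_self _ hk, hk] at this
      exact this.imp_left fun ⟨j, _, h⟩ => h
    intro a ha b hb hab
    rcases key a ha with h | ⟨c, hc, hac, hcU⟩
    · exact Or.inl h
    rcases key b hb with h | ⟨d, hd, hbd, hdU⟩
    · exact Or.inr h
    have hac' := hT.1 hac
    have hbd' := hT.1 hbd
    -- From `a ⊔ b`, `a → c` and `b → d` follows `c ⊔ d`, whose complement lies in `U`.
    refine absurd ?_ (hTU (c ⊔ d) (hSs c hc d hd) ?_)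
    · rw [compl_sup]
      exact hU _ hcU _ hdU
    · have h1 := hT.inf_mem hac hbd (hac'.inf _ _ hbd')
      refine hT.mem_of_le (hT.inf_mem hab h1 (Sg.inf _ _ (ha.sup _ _ hb) (hac'.inf _ _ hbd'))) ?_
        (Sg.sup _ _ (hS hc) (hS hd))
      rw [inf_sup_right]
      refine sup_le ?_ ?_
      · calc a ⊓ ((aᶜ ⊔ c) ⊓ (bᶜ ⊔ d)) ≤ a ⊓ (aᶜ ⊔ c) := inf_le_inf_left _ inf_le_left
          _ ≤ c := by rw [inf_sup_left, inf_compl_eq_bot, bot_sup_eq]; exact inf_le_right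
          _ ≤ c ⊔ d := le_sup_left
      · calc b ⊓ ((aᶜ ⊔ c) ⊓ (bᶜ ⊔ d)) ≤ b ⊓ (bᶜ ⊔ d) := inf_le_inf_left _ inf_le_right
          _ ≤ d := by rw [inf_sup_left, inf_compl_eq_bot, bot_sup_eq]; exact inf_le_right
          _ ≤ c ⊔ d := le_sup_right
  · intro a ha k hk
    refine (hd a ha k).resolve_right ?_
    rintro ⟨c, hc, h1, h2⟩
    refine hTU c hc (hT.mem_of_le (hT.inf_mem hk h1 ((ha.c _ _).inf _ _ (hT.1 h1))) ?_ (hS hc)) h2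
    rw [inf_sup_left, inf_compl_eq_bot, bot_sup_eq]
    exact inf_le_right

/-- Inseparable filters that leave infinitely many indices fresh extend to a saturated pair. -/
theorem exists_saturated [Countable I] [Countable A] {X₁ X₂ T U : Set A}
    {J : Set I} (hJ : J.Infinite) (hfin : ∀ x : A, (dimSet I x ∩ J).Finite)
    (hTJ : ∀ t ∈ T, ∀ j ∈ J, j ∉ dimSet I t) (hUJ : ∀ u ∈ U, ∀ j ∈ J, j ∉ dimSet I u)
    (hTX : T ⊆ sg I X₁) (hUX : U ⊆ sg I X₂) (hT : ⊤ ∈ T) (hU : ⊤ ∈ U)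
    (hTinf : ∀ a ∈ T, ∀ b ∈ T, a ⊓ b ∈ T) (hUinf : ∀ a ∈ U, ∀ b ∈ U, a ⊓ b ∈ U)
    (h : ∀ t ∈ T, ∀ u ∈ U, ∀ c ∈ sg I X₁ ∩ sg I X₂, t ≤ c → u ≤ cᶜ → False) :
    ∃ T' F' : Set A, Saturated I X₁ X₂ T' F' ∧ T ⊆ T' ∧ ∀ u ∈ U, uᶜ ∈ F' := by
  have h0 : Inseparable (sg I X₁ ∩ sg I X₂) T U ⊤ ⊤ := by
    simpa only [Inseparable, inf_top_eq] using h
  obtain ⟨p, q, hp, hq, hpq, hd⟩ := exists_decided_sequence hJ hfin hTJ hUJ h0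
  set S := sg I X₁ ∩ sg I X₂ with hS
  set T' := limitFilter (sg I X₁) T p
  set U' := limitFilter (sg I X₂) U q
  have hT' : IsTheory (sg I X₁) T' := isTheory_limitFilter hp hT hTinf
  have hU' : IsTheory (sg I X₂) U' := isTheory_limitFilter hq hU hUinf
  have hTU : ∀ c ∈ S, c ∈ T' → cᶜ ∉ U' := by
    rintro c hc ⟨-, n, t, ht, h1⟩ ⟨-, m, u, hu, h2⟩
    exact (hpq (max n m)).2.2 t ht u hu c hc
      ((inf_le_inf_left _ (hp (le_max_left n m))).trans h1)
      ((inf_le_inf_left _ (hq (le_max_right n m))).trans h2)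
  have hSs : ∀ x ∈ S, ∀ y ∈ S, x ⊔ y ∈ S :=
    fun x hx y hy => ⟨hx.1.sup _ _ hy.1, hx.2.sup _ _ hy.2⟩
  have hdc : ∀ a : A, ∃ k : I, k ∉ dimSet I a := by
    intro a
    obtain ⟨k, hk, hk'⟩ := (hJ.sdiff (hfin a)).nonempty
    exact ⟨k, fun h => hk' ⟨h, hk⟩⟩
  have hinfT : ∀ a ∈ T', ∀ b ∈ T', a ⊓ b ∈ T' := fun a ha b hb =>
    hT'.inf_mem ha hb (ha.1.inf _ _ hb.1)
  have hinfU : ∀ a ∈ U', ∀ b ∈ U', a ⊓ b ∈ U' := fun a ha b hb =>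
    hU'.inf_mem ha hb (ha.1.inf _ _ hb.1)
  obtain ⟨hprime, hwit⟩ := prime_and_witness (I := I) (fun x hx => hx.1) hSs hT' hTU hinfU hdc
    fun a ha k => (((hd k a).choose_spec).1 ha).mem_limitFilter hS hT ha
  obtain ⟨hprime', hwit'⟩ := prime_and_witness (I := I) (S := S) (fun x hx => hx.2) hSs hU'
    (fun c hc h1 h2 => hTU cᶜ ⟨hc.1.compl, hc.2.compl⟩ h2 (by rwa [compl_compl])) hinfT hdc
    fun a ha k => (((hd k a).choose_spec).2 ha).mem_limitFilter (by rw [hS, Set.inter_comm]) hU ha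
  -- The construction runs with filters on both sides; the cotheory consists of the complements of
  -- the right one.
  refine ⟨T', {b | bᶜ ∈ U'}, ⟨hT', ?_, ?_, hprime, hwit, ?_, ?_⟩,
    fun t ht => ⟨hTX ht, 0, t, ht, inf_le_left⟩, fun u hu => ?_⟩
  · refine isCotheory_of_ideal (fun b hb => sg_compl_mem_iff.mp hb.1) ?_ ?_ ?_
    · simpa using hU'.top_mem Sg.top
    · intro a ha b hb
      simpa using hinfU _ ha _ hb
    · intro a ha b hb hab
      exact hU'.mem_of_le ha (compl_le_compl hab) hb.compl
  · refine Set.eq_empty_of_forall_notMem fun c hc => hTU c ⟨hc.1.1, ?_⟩ hc.1 hc.2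
    exact sg_compl_mem_iff.mp hc.2.1
  · intro a ha b hb hab
    exact hprime' aᶜ ha.compl bᶜ hb.compl (by simpa using hab)
  · intro a ha k hk
    obtain ⟨j, hj, hjU⟩ := hwit' aᶜ ha.compl k (by simpa [univ] using hk)
    refine ⟨j, fun h => hj fun h' => h (c_compl_eq_iff.mp h'), ?_⟩
    rw [MSA.s_compl] at hjU
    exact hjU
  · refine ⟨?_, 0, u, hu, ?_⟩
    · rw [compl_compl]
      exact hUX hu
    · rw [compl_compl]
      exact inf_le_left

end Henkin

end QML
namespace QML

/-! ### Occurring generators and indices, renaming, countability of terms -/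

namespace Term

variable {I J K G : Type u}

/-- The generators that occur in a term. -/
def gens : Term I G → Set G
  | var g => {g}
  | bot => ∅
  | top => ∅
  | sup t r => t.gens ∪ r.gens
  | inf t r => t.gens ∪ r.gens
  | compl t => t.gens
  | box t => t.gens
  | c _ t => t.gens
  | s _ _ t => t.gens

/-- The indices that occur in a term. -/
def idx : Term I G → Set I
  | var _ => ∅
  | bot => ∅
  | top => ∅
  | sup t r => t.idx ∪ r.idx
  | inf t r => t.idx ∪ r.idx
  | compl t => t.idx
  | box t => t.idx
  | c i t => {i} ∪ t.idx
  | s i j t => {i, j} ∪ t.idx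

theorem finite_gens (t : Term I G) : t.gens.Finite := by
  induction t <;> simp_all [gens]

theorem finite_idx (t : Term I G) : t.idx.Finite := by
  induction t <;> simp_all [idx]

theorem gens_map (f : I → J) (t : Term I G) : (t.map f).gens = t.gens := by
  induction t <;> simp_all [gens, map]

theorem idx_map (f : I → J) (t : Term I G) : (t.map f).idx = f '' t.idx := by
  induction t <;> simp_all [idx, map, Set.image_union, Set.image_insert_eq]

theorem map_map (f : I → J) (g : J → K) (t : Term I G) : (t.map f).map g = t.map (g ∘ f) := by
  induction t <;> simp_all [map]

theorem map_congr {f g : I → J} {t : Term I G} (h : ∀ i ∈ t.idx, f i = g i) :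
    t.map f = t.map g := by
  induction t <;> simp_all [map, idx]

theorem map_id (t : Term I G) : t.map id = t := by
  induction t <;> simp_all [map]

theorem map_map_eq_self {f : I → J} {g : J → I} {t : Term I G}
    (h : ∀ i ∈ t.idx, g (f i) = i) : (t.map f).map g = t := by
  rw [map_map, map_congr (f := g ∘ f) (g := id) h, map_id]

theorem eval_congr {B : Type v} [ModalAlgebra B] [MSA I B] {y z : G → B} {t : Term I G}
    (h : ∀ g ∈ t.gens, y g = z g) : t.eval y = t.eval z := by
  induction t <;> simp_all [eval, gens]

instance [Countable I] [Countable G] : Countable (Term I G) := by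
  -- `D n` consists of the terms of depth less than `n`.
  let D : ℕ → Set (Term I G) := fun n => Nat.rec ∅ (fun _ D =>
    Set.range var ∪ {bot, top} ∪ Set.image2 sup D D ∪ Set.image2 inf D D ∪ compl '' D ∪ box '' D ∪
      Set.image2 c Set.univ D ∪ ⋃ i, Set.image2 (s i) Set.univ D) n
  have hD : ∀ n, (D n).Countable := by
    intro n
    induction n with
    | zero => exact Set.countable_empty
    | succ n ih =>
      refine ((((((((Set.countable_range _).union (Set.toFinite _).countable).union
        (ih.image2 ih _)).union (ih.image2 ih _)).union (ih.image _)).union (ih.image _)).union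
        (Set.countable_univ.image2 ih _)).union (Set.countable_iUnion fun i =>
          Set.countable_univ.image2 ih _))
  have hmono : ∀ n, D n ⊆ D (n + 1) := by
    intro n
    induction n with
    | zero => exact Set.empty_subset _
    | succ n ih =>
      change Set.range var ∪ {bot, top} ∪ Set.image2 sup (D n) (D n) ∪ Set.image2 inf (D n) (D n) ∪
        compl '' D n ∪ box '' D n ∪ Set.image2 c Set.univ (D n) ∪
          ⋃ i, Set.image2 (s i) Set.univ (D n) ⊆ _
      simp only [D] at ih ⊢
      gcongr
  have hmono' : Monotone D := monotone_nat_of_le_succ hmono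
  have hall : ∀ t : Term I G, ∃ n, t ∈ D n := by
    intro t
    induction t with
    | var g => exact ⟨1, by simp [D]⟩
    | bot => exact ⟨1, by simp [D]⟩
    | top => exact ⟨1, by simp [D]⟩
    | sup t r ht hr =>
      obtain ⟨n, hn⟩ := ht
      obtain ⟨m, hm⟩ := hr
      have := Set.mem_image2_of_mem (f := sup) (hmono' (le_max_left n m) hn)
        (hmono' (le_max_right n m) hm)
      exact ⟨max n m + 1, by simp only [D, Set.mem_union]; tauto⟩
    | inf t r ht hr =>
      obtain ⟨n, hn⟩ := ht
      obtain ⟨m, hm⟩ := hr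
      have := Set.mem_image2_of_mem (f := inf) (hmono' (le_max_left n m) hn)
        (hmono' (le_max_right n m) hm)
      exact ⟨max n m + 1, by simp only [D, Set.mem_union]; tauto⟩
    | compl t ht =>
      obtain ⟨n, hn⟩ := ht
      have := Set.mem_image_of_mem compl hn
      exact ⟨n + 1, by simp only [D, Set.mem_union]; tauto⟩
    | box t ht =>
      obtain ⟨n, hn⟩ := ht
      have := Set.mem_image_of_mem box hn
      exact ⟨n + 1, by simp only [D, Set.mem_union]; tauto⟩
    | c i t ht =>
      obtain ⟨n, hn⟩ := ht
      have := Set.mem_image2_of_mem (f := c) (Set.mem_univ i) hn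
      exact ⟨n + 1, by simp only [D, Set.mem_union]; tauto⟩
    | s i j t ht =>
      obtain ⟨n, hn⟩ := ht
      have : s i j t ∈ ⋃ i, Set.image2 (s i) Set.univ (D n) := Set.mem_iUnion.mpr
        ⟨i, Set.mem_image2_of_mem (f := s i) (Set.mem_univ j) hn⟩
      exact ⟨n + 1, by simp only [D, Set.mem_union]; tauto⟩
  have : (⋃ n, D n) = Set.univ := by
    ext t
    simpa using hall t
  exact Set.countable_univ_iff.mp (this ▸ Set.countable_iUnion hD)

end Term

/-! ### Renaming along bijections of the index sets -/

section Reduct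

variable {I J G : Type u}

/-- The reduct of an algebra of dimension `J` along an injection of index sets. -/
abbrev MSA.reduct {f : I → J} (hf : Function.Injective f) (B : Type v) [ModalAlgebra B]
    [MSA J B] : MSA I B where
  c i := MSA.c (f i)
  s i j := MSA.s (f i) (f j)
  c_bot _ := MSA.c_bot _
  le_c _ := MSA.le_c _
  c_inf_c _ := MSA.c_inf_c _
  c_sup _ := MSA.c_sup _
  c_comm _ _ := MSA.c_comm _ _
  s_self _ := MSA.s_self _
  s_sup _ _ := MSA.s_sup _ _
  s_inf _ _ := MSA.s_inf _ _
  s_compl _ _ := MSA.s_compl _ _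
  s_bot _ _ := MSA.s_bot _ _
  s_top _ _ := MSA.s_top _ _
  s_box _ _ := MSA.s_box _ _
  s_c_same _ _ := MSA.s_c_same _ _
  c_s_same _ _ _ h := MSA.c_s_same _ _ _ (hf.ne h)
  s_c_comm _ _ _ _ h h' := MSA.s_c_comm _ _ _ _ (hf.ne h) (hf.ne h')
  c_s_swap _ _ := MSA.c_s_swap _ _
  s_comm _ _ _ _ _ h₁ h₂ h₃ h₄ h₅ h₆ := MSA.s_comm _ _ _ _ _ (hf.ne h₁) (hf.ne h₂) (hf.ne h₃)
    (hf.ne h₄) (hf.ne h₅) (hf.ne h₆)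
  s_s _ _ _ := MSA.s_s _ _ _

theorem Term.eval_map {f : I → J} (hf : Function.Injective f) {B : Type v} [ModalAlgebra B]
    [MSA J B] (y : G → B) (t : Term I G) :
    (t.map f).eval y = @Term.eval I G B _ (MSA.reduct hf B) y t := by
  induction t <;> simp_all only [Term.map, Term.eval] <;> rfl

theorem dimSet_reduct {f : I → J} (hf : Function.Injective f) {B : Type v} [ModalAlgebra B]
    [MSA J B] (x : B) : @dimSet I B _ (MSA.reduct hf B) x = f ⁻¹' dimSet J x :=
  rfl

theorem inClass_reduct (e : I ≃ J) {B : Type v} [ModalAlgebra B] [MSA J B]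
    {Λ : Set ModalAxiom} (h : InClass J B Λ) :
    @InClass I B _ (MSA.reduct e.injective B) Λ := by
  refine ⟨fun x => ?_, h.2⟩
  rw [dimSet_reduct, ← Set.preimage_compl]
  exact (h.1 x).preimage (by simp [e.surjective.range_eq])

variable {Λ : Set ModalAxiom} {ρ : G → Set I} {ρ' : G → Set J}

/-- Equality of terms in the free algebra is kept by bijections of the indices that respect
the dimension restrictions of the generators which occur. -/
theorem Cr.map_equiv (e : I ≃ J) {t r : Term I G}
    (h : ∀ g ∈ t.gens ∪ r.gens, ∀ i, e i ∈ ρ' g → i ∈ ρ g) (H : Cr Λ ρ t r) :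
    Cr Λ ρ' (t.map e) (r.map e) := by
  classical
  intro B _ _ hB y hy
  rw [Term.eval_map e.injective, Term.eval_map e.injective]
  let _ := MSA.reduct e.injective B
  -- Generators that do not occur may violate `ρ`, so they are sent to `⊥`, which has empty
  -- dimension set.
  let z : G → B := fun g => if g ∈ t.gens ∪ r.gens then y g else ⊥
  have hz : ∀ g, dimSet I (z g) ⊆ ρ g := by
    intro g i hi
    by_cases hg : g ∈ t.gens ∪ r.gens
    · simp only [z, if_pos hg] at hi
      exact h g hg i (hy g hi)
    · simp only [z, if_neg hg] at hi
      exact absurd (MSA.c_bot i) hi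
  have key := H B (inClass_reduct e hB) z hz
  have hy' : ∀ g ∈ t.gens ∪ r.gens, z g = y g := fun g hg => if_pos hg
  rwa [Term.eval_congr fun g hg => hy' g (Or.inl hg),
    Term.eval_congr fun g hg => hy' g (Or.inr hg)] at key

/-- The infinite set `ι '' Kᶜ` absorbs the countably many indices outside the range, so the
complements of `K` and of `ι '' K` have the same cardinality. -/
theorem exists_equiv_eqOn {ι : I → J} (hι : Function.Injective ι)
    (hc : (Set.range ι)ᶜ.Countable) {K : Set I} (hK : Kᶜ.Infinite) :
    ∃ e : I ≃ J, ∀ i ∈ K, e i = ι i := by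
  let f : K ↪ J := ⟨fun i => ι i, fun i j h => Subtype.ext (hι h)⟩
  have hf : (Set.range f)ᶜ = ι '' Kᶜ ∪ (Set.range ι)ᶜ := by
    have : Set.range f = ι '' K := by
      ext j
      exact ⟨fun ⟨i, hi⟩ => ⟨i, i.2, hi⟩, fun ⟨i, hi, h⟩ => ⟨⟨i, hi⟩, h⟩⟩
    rw [this, Set.image_compl_eq_range_sdiff_image hι]
    ext j
    simp only [Set.mem_compl_iff, Set.mem_union, Set.mem_sdiff]
    have : j ∈ ι '' K → j ∈ Set.range ι := fun h => Set.image_subset_range _ _ h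
    tauto
  have hcard : Cardinal.mk (Kᶜ : Set I) = Cardinal.mk ((Set.range f)ᶜ : Set J) := by
    rw [hf, Cardinal.mk_union_of_disjoint, Cardinal.mk_image_eq hι, Cardinal.add_eq_left]
    · exact Cardinal.infinite_iff.mp hK.to_subtype
    · exact (Cardinal.le_aleph0_iff_set_countable.mpr hc).trans
        (Cardinal.infinite_iff.mp hK.to_subtype)
    · exact disjoint_compl_right.mono_left (Set.image_subset_range _ _)
  obtain ⟨e, he⟩ := Cardinal.extend_function f (Cardinal.eq.mp hcard)
  exact ⟨e, fun i hi => he ⟨i, hi⟩⟩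

end Reduct

/-- The dimension restrictions `ρ'` on the index set `J` come from restrictions `ρ` on `I`, where
`J` has countably many further indices. -/
structure Extends {I J G : Type u} (ι : I → J) (ρ : G → Set I) (ρ' : G → Set J) : Prop where
  inj : Function.Injective ι
  countable : (Set.range ι)ᶜ.Countable
  restr : ∀ g, ρ' g = ι '' ρ g
  infinite : ∀ Γ : Set G, Γ.Finite → (⋃ g ∈ Γ, ρ g)ᶜ.Infinite

/-! ### Canonical embeddings of free algebras -/

section Embedding

variable {I J G : Type u} {Λ : Set ModalAxiom} {ρ : G → Set I} {ρ' : G → Set J} {ι : I → J}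

/-- Apply `exists_equiv_eqOn` to `S` together with all `ρ g`, `g ∈ Γ`. The last two clauses are what
`Cr.map_equiv` needs for `e` and for `e.symm`. -/
theorem Extends.exists_equiv (h : Extends ι ρ ρ') {Γ : Set G} (hΓ : Γ.Finite) {S : Set I}
    (hS : S.Finite) : ∃ e : I ≃ J, (∀ i ∈ S, e i = ι i) ∧
      (∀ g ∈ Γ, ∀ i, e i ∈ ρ' g → i ∈ ρ g) ∧ ∀ g ∈ Γ, ∀ j, e.symm j ∈ ρ g → j ∈ ρ' g := by
  have hK : (S ∪ ⋃ g ∈ Γ, ρ g)ᶜ.Infinite := by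
    rw [Set.compl_union, Set.inter_comm, ← Set.sdiff_eq]
    exact (h.infinite Γ hΓ).sdiff hS
  obtain ⟨e, he⟩ := exists_equiv_eqOn h.inj h.countable hK
  have he' : ∀ g ∈ Γ, ∀ i ∈ ρ g, e i = ι i := fun g hg i hi =>
    he i (Or.inr (Set.mem_biUnion hg hi))
  refine ⟨e, fun i hi => he i (Or.inl hi), fun g hg i hi => ?_, fun g hg j hj => ?_⟩
  · rw [h.restr] at hi
    obtain ⟨k, hk, hki⟩ := hi
    rw [← he' g hg k hk] at hki
    exact e.injective hki ▸ hk
  · rw [h.restr]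
    exact ⟨_, hj, by rw [← he' g hg _ hj, e.apply_symm_apply]⟩

/-- On the indices that occur, `ι` agrees with a bijection. One direction makes the canonical
embedding well defined, the other makes it injective. -/
theorem Extends.cr_map_iff (h : Extends ι ρ ρ') {t r : Term I G} :
    Cr Λ ρ' (t.map ι) (r.map ι) ↔ Cr Λ ρ t r := by
  obtain ⟨e, he, he₁, he₂⟩ := h.exists_equiv (t.finite_gens.union r.finite_gens)
    (t.finite_idx.union r.finite_idx)
  rw [Term.map_congr (g := e) fun i hi => (he i (Or.inl hi)).symm,
    Term.map_congr (f := ι) (g := e) (t := r) fun i hi => (he i (Or.inr hi)).symm]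
  refine ⟨fun H => ?_, fun H => H.map_equiv e he₁⟩
  have := H.map_equiv e.symm (ρ' := ρ) (by simpa only [Term.gens_map] using he₂)
  rwa [Term.map_map_eq_self (by simp), Term.map_map_eq_self (by simp)] at this

/-- Equations hold in the larger algebra if their renamed versions hold in the smaller one. -/
theorem Extends.exists_cr_imp (h : Extends ι ρ ρ') (t r : Term J G) :
    ∃ f : J → I, Cr Λ ρ (t.map f) (r.map f) → Cr Λ ρ' t r := by
  obtain ⟨e, -, he₁, he₂⟩ := h.exists_equiv (t.finite_gens.union r.finite_gens) Set.finite_empty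
  refine ⟨e.symm, fun H => ?_⟩
  have := H.map_equiv e (ρ' := ρ') (by simpa only [Term.gens_map] using he₁)
  rwa [Term.map_map_eq_self (by simp), Term.map_map_eq_self (by simp)] at this

/-- The canonical embedding of free algebras. -/
def Extends.embed (h : Extends ι ρ ρ') : Fr Λ ρ → Fr Λ ρ' :=
  Quotient.map (Term.map ι) fun _ _ H => h.cr_map_iff.mpr H

theorem Extends.embed_mk (h : Extends ι ρ ρ') (t : Term I G) :
    h.embed (Fr.mk t : Fr Λ ρ) = Fr.mk (t.map ι) :=
  rfl

theorem Fr.exists_mk_eq (x : Fr Λ ρ) : ∃ t, Fr.mk t = x :=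
  Fr.ind (p := fun x => ∃ t, Fr.mk t = x) (fun t => ⟨t, rfl⟩) x

theorem Extends.embed_injective (h : Extends ι ρ ρ') :
    Function.Injective (h.embed (Λ := Λ)) := fun x y H => by
  obtain ⟨t, rfl⟩ := Fr.exists_mk_eq x
  obtain ⟨r, rfl⟩ := Fr.exists_mk_eq y
  exact Fr.sound (h.cr_map_iff.mp (Fr.exact H))

section Operations

variable (h : Extends ι ρ ρ')

theorem Extends.embed_top : h.embed (⊤ : Fr Λ ρ) = ⊤ := rfl

theorem Extends.embed_sup (x y : Fr Λ ρ) : h.embed (x ⊔ y) = h.embed x ⊔ h.embed y :=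
  Fr.ind (p := fun x => h.embed (x ⊔ y) = h.embed x ⊔ h.embed y) (fun t =>
    Fr.ind (p := fun y => h.embed (Fr.mk t ⊔ y) = h.embed (Fr.mk t) ⊔ h.embed y)
      (fun _ => rfl) y) x

theorem Extends.embed_inf (x y : Fr Λ ρ) : h.embed (x ⊓ y) = h.embed x ⊓ h.embed y :=
  Fr.ind (p := fun x => h.embed (x ⊓ y) = h.embed x ⊓ h.embed y) (fun t =>
    Fr.ind (p := fun y => h.embed (Fr.mk t ⊓ y) = h.embed (Fr.mk t) ⊓ h.embed y)
      (fun _ => rfl) y) x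

theorem Extends.embed_compl (x : Fr Λ ρ) : h.embed xᶜ = (h.embed x)ᶜ :=
  Fr.ind (p := fun x => h.embed xᶜ = (h.embed x)ᶜ) (fun _ => rfl) x

theorem Extends.embed_box (x : Fr Λ ρ) : h.embed (box x) = box (h.embed x) :=
  Fr.ind (p := fun x => h.embed (box x) = box (h.embed x)) (fun _ => rfl) x

theorem Extends.embed_dia (x : Fr Λ ρ) : h.embed (dia x) = dia (h.embed x) := by
  rw [dia, dia, embed_compl, embed_box, embed_compl]

theorem Extends.embed_c (i : I) (x : Fr Λ ρ) : h.embed (MSA.c i x) = MSA.c (ι i) (h.embed x) :=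
  Fr.ind (p := fun x => h.embed (MSA.c i x) = MSA.c (ι i) (h.embed x)) (fun _ => rfl) x

theorem Extends.embed_s (i j : I) (x : Fr Λ ρ) :
    h.embed (MSA.s i j x) = MSA.s (ι i) (ι j) (h.embed x) :=
  Fr.ind (p := fun x => h.embed (MSA.s i j x) = MSA.s (ι i) (ι j) (h.embed x)) (fun _ => rfl) x

theorem Extends.embed_le_iff {x y : Fr Λ ρ} : h.embed x ≤ h.embed y ↔ x ≤ y := by
  rw [← sup_eq_right, ← h.embed_sup, h.embed_injective.eq_iff, sup_eq_right]

theorem Extends.embed_mem_sg {X : Set (Fr Λ ρ)} {x : Fr Λ ρ} (hx : x ∈ sg I X) :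
    h.embed x ∈ sg J (h.embed '' X) := by
  change Sg I X x at hx
  induction hx with
  | basic x hx => exact Sg.basic _ ⟨x, hx, rfl⟩
  | bot => exact Sg.bot
  | top => exact Sg.top
  | sup x y _ _ hx hy => rw [h.embed_sup]; exact Sg.sup _ _ hx hy
  | inf x y _ _ hx hy => rw [h.embed_inf]; exact Sg.inf _ _ hx hy
  | compl x _ hx => rw [h.embed_compl]; exact Sg.compl _ hx
  | box x _ hx => rw [h.embed_box]; exact Sg.box _ hx
  | c i x _ hx => rw [h.embed_c]; exact Sg.c _ _ hx
  | s i j x _ hx => rw [h.embed_s]; exact Sg.s _ _ _ hx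

end Operations

theorem Extends.valid_D (h : Extends ι ρ ρ') (hA : dia (⊤ : Fr Λ ρ) = ⊤) :
    dia (⊤ : Fr Λ ρ') = ⊤ := by
  rw [← h.embed_top, ← h.embed_dia, hA]

/-- The axiom is assumed for the smaller algebra only and need not belong to `Λ`. Each instance in
the larger algebra is a single equation, which is renamed into the smaller one. -/
theorem Extends.valid_T (h : Extends ι ρ ρ') (hA : ∀ p : Fr Λ ρ, (box p)ᶜ ⊔ p = ⊤) :
    ∀ p : Fr Λ ρ', (box p)ᶜ ⊔ p = ⊤ := by
  refine Fr.ind fun t => ?_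
  obtain ⟨f, hf⟩ := h.exists_cr_imp (Λ := Λ) (.sup (.compl (.box t)) t) .top
  exact Fr.sound (hf (Fr.exact (hA (Fr.mk (t.map f)))))

theorem Extends.valid_four (h : Extends ι ρ ρ')
    (hA : ∀ p : Fr Λ ρ, (box p)ᶜ ⊔ box (box p) = ⊤) :
    ∀ p : Fr Λ ρ', (box p)ᶜ ⊔ box (box p) = ⊤ := by
  refine Fr.ind fun t => ?_
  obtain ⟨f, hf⟩ := h.exists_cr_imp (Λ := Λ) (.sup (.compl (.box t)) (.box (.box t))) .top
  exact Fr.sound (hf (Fr.exact (hA (Fr.mk (t.map f)))))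

theorem Term.dimSet_eval_subset {B : Type v} [ModalAlgebra B] [MSA I B] (hB : IsDc I B)
    {y : G → B} (hy : ∀ g, dimSet I (y g) ⊆ ρ g) (t : Term I G) :
    dimSet I (t.eval y) ⊆ t.idx ∪ ⋃ g ∈ t.gens, ρ g := by
  intro i
  contrapose!
  intro hi
  -- The case of `□` needs a second index (`c_box_eq`); dimension complementedness provides one.
  obtain ⟨j, -, hj⟩ := ((hB ⊤).sdiff (Set.finite_singleton i)).nonempty
  have hij : i ≠ j := fun h => hj h.symm
  rw [Set.mem_union, Set.mem_iUnion₂, not_or, not_exists] at hi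
  obtain ⟨hi, hρ⟩ := hi
  refine notMem_dimSet_of_c_eq ?_
  induction t with
  | var g =>
    exact c_eq_of_notMem_dimSet fun h' => hρ g ⟨rfl, hy g h'⟩
  | bot => exact MSA.c_bot i
  | top => exact top_le_iff.mp (MSA.le_c i _)
  | sup t r ht hr =>
    simp only [idx, Set.mem_union, not_or] at hi
    rw [eval, MSA.c_sup, ht hi.1 fun g ⟨hg, h'⟩ => hρ g ⟨Or.inl hg, h'⟩,
      hr hi.2 fun g ⟨hg, h'⟩ => hρ g ⟨Or.inr hg, h'⟩]
  | inf t r ht hr =>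
    simp only [idx, Set.mem_union, not_or] at hi
    exact c_inf_eq (ht hi.1 fun g ⟨hg, h'⟩ => hρ g ⟨Or.inl hg, h'⟩)
      (hr hi.2 fun g ⟨hg, h'⟩ => hρ g ⟨Or.inr hg, h'⟩)
  | compl t ht => exact c_compl_eq (ht hi hρ)
  | box t ht => exact c_box_eq hij (ht hi hρ)
  | c k t ht =>
    simp only [idx, Set.mem_union, not_or] at hi
    rw [eval, MSA.c_comm, ht hi.2 hρ]
  | s k l t ht =>
    simp only [idx, Set.mem_union, Set.mem_insert_iff, Set.mem_singleton_iff, not_or] at hi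
    rw [eval, ← MSA.s_c_comm l k i _ hi.1.2 hi.1.1, ht hi.2 hρ]

theorem Fr.dimSet_mk_subset (t : Term I G) :
    dimSet I (Fr.mk t : Fr Λ ρ) ⊆ t.idx ∪ ⋃ g ∈ t.gens, ρ g := by
  intro i
  contrapose!
  intro hi
  refine notMem_dimSet_of_c_eq (Fr.sound (t := .c i t) fun B _ _ hB y hy => ?_)
  exact c_eq_of_notMem_dimSet fun h => hi (Term.dimSet_eval_subset hB.1 hy t h)

theorem Extends.mem_dimSet_embed (h : Extends ι ρ ρ') (i : I) (x : Fr Λ ρ) :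
    ι i ∈ dimSet J (h.embed x) ↔ i ∈ dimSet I x := by
  simp only [dimSet, Set.mem_ofPred_eq, ne_eq, ← h.embed_c, h.embed_injective.eq_iff]

theorem Extends.dimSet_embed_subset (h : Extends ι ρ ρ') (x : Fr Λ ρ) :
    dimSet J (h.embed x) ⊆ Set.range ι := by
  refine Fr.ind (p := fun x => dimSet J (h.embed x) ⊆ Set.range ι) (fun t => ?_) x
  refine (Fr.dimSet_mk_subset _).trans (Set.union_subset ?_ ?_)
  · rw [Term.idx_map]
    exact Set.image_subset_range _ _
  · refine Set.iUnion₂_subset fun g _ => ?_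
    rw [h.restr]
    exact Set.image_subset_range _ _

theorem Extends.dimSet_embed (h : Extends ι ρ ρ') (x : Fr Λ ρ) :
    dimSet J (h.embed x) = ι '' dimSet I x := by
  ext j
  constructor
  · intro hj
    obtain ⟨i, rfl⟩ := h.dimSet_embed_subset x hj
    exact ⟨i, (h.mem_dimSet_embed i x).mp hj, rfl⟩
  · rintro ⟨i, hi, rfl⟩
    exact (h.mem_dimSet_embed i x).mpr hi

/-- Generators are restricted to old indices, so an element depends on a new index only if that
index occurs in its term. This keeps fresh indices available in the Henkin construction. -/
theorem Extends.finite_dimSet_inter (h : Extends ι ρ ρ') (x : Fr Λ ρ') :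
    (dimSet J x ∩ (Set.range ι)ᶜ).Finite := by
  refine Fr.ind (p := fun x => (dimSet J x ∩ (Set.range ι)ᶜ).Finite) (fun t => ?_) x
  refine t.finite_idx.subset ?_
  rintro j ⟨hj, hjι⟩
  refine (Fr.dimSet_mk_subset t hj).resolve_right fun hj' => hjι ?_
  obtain ⟨g, -, hg⟩ := Set.mem_iUnion₂.mp hj'
  rw [h.restr] at hg
  exact Set.image_subset_range _ _ hg

/-- The elements of the generated subalgebra of the larger algebra are given by terms whose
renamed versions give elements of the generated subalgebra of the smaller one. -/
theorem Extends.exists_term_of_mem_sg (h : Extends ι ρ ρ') {X : Set (Fr Λ ρ)} {x : Fr Λ ρ'}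
    (hx : x ∈ sg J (h.embed '' X)) : ∃ (t : Term J G) (S : Set I), S.Finite ∧ x = Fr.mk t ∧
      ∀ f : J → I, (∀ i ∈ S, f (ι i) = i) → Fr.mk (t.map f) ∈ sg I X := by
  -- `S` collects the indices of the terms chosen for elements of `X`. The result speaks of a term
  -- instead of `x` because `Cr` need not survive renaming by an arbitrary `f`.
  change Sg J (h.embed '' X) x at hx
  induction hx with
  | basic x hx =>
    obtain ⟨x, ht, rfl⟩ := hx
    obtain ⟨t, rfl⟩ := Fr.exists_mk_eq x
    refine ⟨t.map ι, t.idx, t.finite_idx, rfl, fun f hf => ?_⟩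
    rw [Term.map_map_eq_self hf]
    exact Sg.basic _ ht
  | bot => exact ⟨.bot, ∅, Set.finite_empty, rfl, fun _ _ => Sg.bot⟩
  | top => exact ⟨.top, ∅, Set.finite_empty, rfl, fun _ _ => Sg.top⟩
  | sup x y _ _ hx hy =>
    obtain ⟨t, S, hS, rfl, ht⟩ := hx
    obtain ⟨r, S', hS', rfl, hr⟩ := hy
    exact ⟨.sup t r, S ∪ S', hS.union hS', rfl, fun f hf => Sg.sup _ _
      (ht f fun i hi => hf i (Or.inl hi)) (hr f fun i hi => hf i (Or.inr hi))⟩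
  | inf x y _ _ hx hy =>
    obtain ⟨t, S, hS, rfl, ht⟩ := hx
    obtain ⟨r, S', hS', rfl, hr⟩ := hy
    exact ⟨.inf t r, S ∪ S', hS.union hS', rfl, fun f hf => Sg.inf _ _
      (ht f fun i hi => hf i (Or.inl hi)) (hr f fun i hi => hf i (Or.inr hi))⟩
  | compl x _ hx =>
    obtain ⟨t, S, hS, rfl, ht⟩ := hx
    exact ⟨.compl t, S, hS, rfl, fun f hf => Sg.compl _ (ht f hf)⟩
  | box x _ hx =>
    obtain ⟨t, S, hS, rfl, ht⟩ := hx
    exact ⟨.box t, S, hS, rfl, fun f hf => Sg.box _ (ht f hf)⟩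
  | c i x _ hx =>
    obtain ⟨t, S, hS, rfl, ht⟩ := hx
    exact ⟨.c i t, S, hS, rfl, fun f hf => Sg.c _ _ (ht f hf)⟩
  | s i j x _ hx =>
    obtain ⟨t, S, hS, rfl, ht⟩ := hx
    exact ⟨.s i j t, S, hS, rfl, fun f hf => Sg.s _ _ _ (ht f hf)⟩

/-- Elements of the smaller algebra that are separated in the larger one are already separated
in the smaller one. -/
theorem Extends.exists_separator (h : Extends ι ρ ρ') {X₁ X₂ : Set (Fr Λ ρ)} {x y : Fr Λ ρ}
    {z : Fr Λ ρ'} (hz₁ : z ∈ sg J (h.embed '' X₁)) (hz₂ : z ∈ sg J (h.embed '' X₂))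
    (hx : h.embed x ≤ z) (hy : h.embed y ≤ zᶜ) :
    ∃ w, w ∈ sg I X₁ ∧ w ∈ sg I X₂ ∧ x ≤ w ∧ y ≤ wᶜ := by
  obtain ⟨t₁, S₁, hS₁, rfl, ht₁⟩ := h.exists_term_of_mem_sg hz₁
  obtain ⟨t₂, S₂, hS₂, h12, ht₂⟩ := h.exists_term_of_mem_sg hz₂
  obtain ⟨r₁, rfl⟩ := Fr.exists_mk_eq x
  obtain ⟨r₂, rfl⟩ := Fr.exists_mk_eq y
  -- The two memberships of `z` yield two terms. One bijection must bring down both inequalities and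
  -- the equality of these terms, so it respects the generators of all four terms.
  obtain ⟨e, he, -, he₂⟩ := h.exists_equiv
    (((t₁.finite_gens.union t₂.finite_gens).union r₁.finite_gens).union r₂.finite_gens)
    (((hS₁.union hS₂).union r₁.finite_idx).union r₂.finite_idx)
  have hs : ∀ i ∈ S₁ ∪ S₂ ∪ r₁.idx ∪ r₂.idx, e.symm (ι i) = i := fun i hi => by
    rw [← he i hi, e.symm_apply_apply]
  have hr₁' : (r₁.map ι).map e.symm = r₁ :=
    Term.map_map_eq_self fun i hi => hs i (Or.inl (Or.inr hi))
  have hr₂' : (r₂.map ι).map e.symm = r₂ := Term.map_map_eq_self fun i hi => hs i (Or.inr hi)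
  have k₀ := (Fr.exact h12).map_equiv e.symm (ρ' := ρ) fun g hg j hj =>
    he₂ g (Or.inl (Or.inl hg)) j hj
  have k₁ := (Fr.exact (t := .sup (r₁.map ι) t₁) hx).map_equiv e.symm (ρ' := ρ)
    fun g hg j hj => he₂ g (by
      simp only [Term.gens, Term.gens_map, Set.mem_union] at hg ⊢
      tauto) j hj
  have k₂ := (Fr.exact (t := .sup (r₂.map ι) (.compl t₁)) (r := .compl t₁) hy).map_equiv
    e.symm (ρ' := ρ) fun g hg j hj => he₂ g (by
      simp only [Term.gens, Term.gens_map, Set.mem_union] at hg ⊢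
      tauto) j hj
  simp only [Term.map, hr₁', hr₂'] at k₁ k₂
  refine ⟨Fr.mk (t₁.map e.symm), ht₁ _ fun i hi => hs i (Or.inl (Or.inl (Or.inl hi))), ?_,
    Fr.sound k₁, Fr.sound k₂⟩
  rw [Fr.sound k₀]
  exact ht₂ _ fun i hi => hs i (Or.inl (Or.inl (Or.inr hi)))

instance [Countable I] [Countable G] : Countable (Fr Λ ρ) :=
  inferInstanceAs (Countable (Quotient _))

/-- In the free algebra all axioms of `Λ` are valid. -/
theorem Fr.valid_D (h : ModalAxiom.D ∈ Λ) : dia (⊤ : Fr Λ ρ) = ⊤ :=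
  Fr.sound (t := .compl (.box (.compl .top))) (r := .top) fun _ _ _ hB _ _ => hB.2 _ h

theorem Fr.valid_T (h : ModalAxiom.T ∈ Λ) : ∀ p : Fr Λ ρ, (box p)ᶜ ⊔ p = ⊤ :=
  Fr.ind fun t => Fr.sound (t := .sup (.compl (.box t)) t) (r := .top)
    fun _ _ _ hB _ _ => hB.2 _ h _

theorem Fr.valid_four (h : ModalAxiom.four ∈ Λ) :
    ∀ p : Fr Λ ρ, (box p)ᶜ ⊔ box (box p) = ⊤ :=
  Fr.ind fun t => Fr.sound (t := .sup (.compl (.box t)) (.box (.box t))) (r := .top)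
    fun _ _ _ hB _ _ => hB.2 _ h _

end Embedding

end QML
namespace QML

/-! ### Generators with empty dimension sets -/

section Trivial

variable {I J G : Type u} {Λ : Set ModalAxiom} {ρ : G → Set I} {ρ' : G → Set J} {ι : I → J}

theorem Extends.exists_ne (h : Extends ι ρ ρ') (j : J) : ∃ k : J, j ≠ k := by
  have h1 : Infinite I := Set.infinite_univ_iff.mp
    ((h.infinite ∅ Set.finite_empty).mono (Set.subset_univ _))
  have h2 : Infinite J := Infinite.of_injective ι h.inj
  obtain ⟨k, hk⟩ := _root_.exists_ne j
  exact ⟨k, hk.symm⟩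

/-- If the dimension sets of the generators are empty, then the generated subalgebra does not
depend on the dimension. -/
theorem Extends.exists_of_mem_sg (h : Extends ι ρ ρ') {X : Set (Fr Λ ρ)}
    (hX : ∀ x ∈ X, dimSet I x = ∅) {y : Fr Λ ρ'} (hy : y ∈ sg J (h.embed '' X)) :
    (∀ j : J, MSA.c j y = y) ∧ ∃ x ∈ sg I X, h.embed x = y := by
  change Sg J (h.embed '' X) y at hy
  induction hy with
  | basic y hy =>
    obtain ⟨x, hx, rfl⟩ := hy
    refine ⟨fun j => c_eq_of_notMem_dimSet ?_, x, Sg.basic _ hx, rfl⟩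
    simp [h.dimSet_embed, hX x hx]
  | bot => exact ⟨MSA.c_bot, ⊥, Sg.bot, rfl⟩
  | top => exact ⟨fun j => top_le_iff.mp (MSA.le_c j _), ⊤, Sg.top, rfl⟩
  | sup y z _ _ hy hz =>
    obtain ⟨hy, y, hyX, rfl⟩ := hy
    obtain ⟨hz, z, hzX, rfl⟩ := hz
    exact ⟨fun j => by rw [MSA.c_sup, hy, hz], y ⊔ z, Sg.sup _ _ hyX hzX, h.embed_sup _ _⟩
  | inf y z _ _ hy hz =>
    obtain ⟨hy, y, hyX, rfl⟩ := hy
    obtain ⟨hz, z, hzX, rfl⟩ := hz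
    exact ⟨fun j => c_inf_eq (hy j) (hz j), y ⊓ z, Sg.inf _ _ hyX hzX, h.embed_inf _ _⟩
  | compl y _ hy =>
    obtain ⟨hy, y, hyX, rfl⟩ := hy
    exact ⟨fun j => c_compl_eq (hy j), yᶜ, Sg.compl _ hyX, h.embed_compl _⟩
  | box y _ hy =>
    obtain ⟨hy, y, hyX, rfl⟩ := hy
    exact ⟨fun j => c_box_eq (h.exists_ne j).choose_spec (hy j), box y, Sg.box _ hyX,
      h.embed_box _⟩
  | c i y _ hy => rwa [hy.1 i]
  | s i j y _ hy => rwa [s_eq_self _ (hy.1 j)]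

/-- Pull the pair back along the embedding. The witness conditions become trivial: `c_k a = a =
s_k^k a`, so `k` is its own witness. -/
theorem Extends.exists_saturated_of_trivial (h : Extends ι ρ ρ') {X₁ X₂ : Set (Fr Λ ρ)}
    (hX₁ : ∀ x ∈ X₁, dimSet I x = ∅) (hX₂ : ∀ x ∈ X₂, dimSet I x = ∅) {T F : Set (Fr Λ ρ')}
    (hTF : Saturated J (h.embed '' X₁) (h.embed '' X₂) T F) :
    ∃ T₀ F₀, Saturated I X₁ X₂ T₀ F₀ ∧ h.embed '' T₀ = T ∧ h.embed '' F₀ = F := by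
  have hc : ∀ {X : Set (Fr Λ ρ)}, (∀ x ∈ X, dimSet I x = ∅) → ∀ x ∈ sg I X, ∀ i : I,
      MSA.c i x = x := fun hX x hx i => h.embed_injective <| by
    rw [h.embed_c]
    exact (h.exists_of_mem_sg hX (h.embed_mem_sg hx)).1 _
  have hT : h.embed '' (h.embed ⁻¹' T) = T := Set.image_preimage_eq_of_subset fun y hy =>
    (h.exists_of_mem_sg hX₁ (hTF.theory.1 hy)).2.imp fun _ hx => hx.2
  have hF : h.embed '' (h.embed ⁻¹' F) = F := Set.image_preimage_eq_of_subset fun y hy =>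
    (h.exists_of_mem_sg hX₂ (hTF.cotheory.1 hy)).2.imp fun _ hx => hx.2
  have hTX : h.embed ⁻¹' T ⊆ sg I X₁ := fun y hy => by
    obtain ⟨x, hx, hxy⟩ := (h.exists_of_mem_sg hX₁ (hTF.theory.1 hy)).2
    exact h.embed_injective hxy ▸ hx
  have hFX : h.embed ⁻¹' F ⊆ sg I X₂ := fun y hy => by
    obtain ⟨x, hx, hxy⟩ := (h.exists_of_mem_sg hX₂ (hTF.cotheory.1 hy)).2
    exact h.embed_injective hxy ▸ hx
  refine ⟨h.embed ⁻¹' T, h.embed ⁻¹' F, ⟨?_, ?_, ?_, ?_, ?_, ?_, ?_⟩, hT, hF⟩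
  · refine isTheory_of_filter hTX (hTF.theory.top_mem Sg.top) ?_ ?_
    · intro a ha b hb
      rw [Set.mem_preimage, h.embed_inf]
      exact hTF.theory.inf_mem ha hb (Sg.inf _ _ (hTF.theory.1 ha) (hTF.theory.1 hb))
    · intro a ha b hb hab
      exact hTF.theory.mem_of_le ha (h.embed_le_iff.mpr hab) (h.embed_mem_sg hb)
  · refine isCotheory_of_ideal hFX (hTF.cotheory.bot_mem Sg.bot) ?_ ?_
    · intro a ha b hb
      rw [Set.mem_preimage, h.embed_sup]
      exact hTF.cotheory.sup_mem ha hb (Sg.sup _ _ (hTF.cotheory.1 ha) (hTF.cotheory.1 hb))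
    · intro a ha b hb hab
      exact hTF.cotheory.mem_of_le ha (h.embed_le_iff.mpr hab) (h.embed_mem_sg hb)
  · rw [← Set.preimage_inter, hTF.disjoint, Set.preimage_empty]
  · intro a ha b hb hab
    rw [Set.mem_preimage, h.embed_sup] at hab
    exact hTF.prime_left _ (h.embed_mem_sg ha) _ (h.embed_mem_sg hb) hab
  · intro a ha k hk
    rw [hc hX₁ a ha k] at hk
    exact ⟨k, notMem_dimSet_of_c_eq (hc hX₁ a ha k), by rwa [MSA.s_self]⟩
  · intro a ha b hb hab
    rw [Set.mem_preimage, h.embed_inf] at hab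
    exact hTF.prime_right _ (h.embed_mem_sg ha) _ (h.embed_mem_sg hb) hab
  · intro a ha k hk
    rw [univ, c_compl_eq (hc hX₂ a ha k), compl_compl] at hk
    exact ⟨k, notMem_dimSet_of_c_eq (hc hX₂ a ha k), by rwa [MSA.s_self]⟩

end Trivial

/-! ### The algebras `B_n` and the levels of saturated pairs -/

section Levels

open Ordinal

variable {α β : Ordinal.{u}} {Λ : Set ModalAxiom} {ρ : Set.Iio β → Set (Set.Iio α)}

theorem countable_Iio_omega0_mul_omega0 : (Set.Iio (ω * ω : Ordinal.{u})).Countable := by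
  rw [← Cardinal.le_aleph0_iff_set_countable, Cardinal.mk_Iio_ordinal]
  simp

theorem countable_Iio_dimN (hα : Countable (Set.Iio α)) (n : ℕ) :
    Countable (Set.Iio (dimN α n)) := by
  have h1 := Cardinal.le_aleph0_iff_set_countable.mpr (Set.countable_coe_iff.mp hα)
  rw [Cardinal.mk_Iio_ordinal, Cardinal.lift_le_aleph0] at h1
  rw [← Cardinal.mk_le_aleph0_iff, Cardinal.mk_Iio_ordinal, Cardinal.lift_le_aleph0, dimN,
    card_add, card_mul, card_nat, card_omega0]
  refine Cardinal.add_le_aleph0.mpr ⟨h1, (mul_le_mul' le_rfl Cardinal.natCast_le_aleph0).trans ?_⟩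
  rw [Cardinal.aleph0_mul_aleph0]

theorem dimN_succ (α : Ordinal.{u}) (n : ℕ) : dimN α (n + 1) = dimN α n + ω := by
  rw [dimN, dimN, add_assoc, Nat.cast_succ, mul_add_one]

theorem dimN_strictMono (α : Ordinal.{u}) : StrictMono (dimN α) :=
  strictMono_nat_of_lt_succ fun n => by
    rw [dimN_succ]
    exact lt_add_of_pos_right _ omega0_pos

theorem infinite_compl_range_inclusion (α : Ordinal.{u}) (n : ℕ) :
    (Set.range (Set.inclusion (Set.Iio_subset_Iio (dimN_mono α n.le_succ))))ᶜ.Infinite := by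
  refine Set.infinite_of_injective_forall_mem (f := fun r : ℕ =>
    (⟨dimN α n + r, ?_⟩ : Set.Iio (dimN α (n + 1)))) ?_ ?_
  · rw [Set.mem_Iio, dimN_succ]
    exact add_lt_add_right (natCast_lt_omega0 r) _
  · intro r s hrs
    simpa using hrs
  · rintro r ⟨j, hj⟩
    have h1 : j.1 = dimN α n + r := congrArg Subtype.val hj
    exact absurd j.2 (by rw [h1, Set.mem_Iio, not_lt]; exact le_self_add)

/-- The bound `α + ω * ω` leaves only countably many new indices, even for uncountable `α`. -/
theorem extends_inclusion (hρ : ∀ Γ : Finset (Set.Iio β), (⋃ η ∈ Γ, ρ η)ᶜ.Infinite)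
    {γ δ : Ordinal.{u}} (hα : α ≤ γ) (h : γ ≤ δ) (hδ : δ ≤ α + ω * ω) :
    Extends (Set.inclusion (Set.Iio_subset_Iio h)) (extendRestr ρ γ) (extendRestr ρ δ) where
  inj := Set.inclusion_injective _
  countable := by
    have h1 := countable_Iio_omega0_mul_omega0.image fun x => α + x
    refine Set.MapsTo.countable_of_injOn (f := fun j : Set.Iio δ => j.1) (fun j hj => ?_)
      Subtype.val_injective.injOn h1
    have hj' : α ≤ j.1 := by
      by_contra! hlt
      exact hj ⟨⟨j.1, hlt.trans_le hα⟩, rfl⟩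
    refine ⟨j.1 - α, ?_, Ordinal.add_sub_cancel_of_le hj'⟩
    rw [Set.mem_Iio, ← add_lt_add_iff_left α, Ordinal.add_sub_cancel_of_le hj']
    exact lt_of_lt_of_le j.2 hδ
  restr g := by
    ext j
    constructor
    · rintro ⟨i, hi, hij⟩
      exact ⟨⟨i.1, lt_of_lt_of_le i.2 hα⟩, ⟨i, hi, rfl⟩, Subtype.ext hij⟩
    · rintro ⟨k, ⟨i, hi, hik⟩, rfl⟩
      exact ⟨i, hi, hik⟩
  infinite Γ hΓ := by
    have h1 := (hρ hΓ.toFinset).image (Set.inclusion_injective (Set.Iio_subset_Iio hα)).injOn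
    refine h1.mono ?_
    rintro _ ⟨i, hi, rfl⟩ hi'
    obtain ⟨g, hg, k, hk, hki⟩ := Set.mem_iUnion₂.mp hi'
    exact hi (Set.mem_iUnion₂.mpr ⟨g, hΓ.mem_toFinset.mpr hg, Subtype.ext hki ▸ hk⟩)

theorem push_eq_image {γ δ : Ordinal.{u}} {h : γ ≤ δ}
    (H : Extends (Set.inclusion (Set.Iio_subset_Iio h)) (extendRestr ρ γ) (extendRestr ρ δ))
    (X : Set (FrDim Λ ρ γ)) : push h X = H.embed '' X := by
  ext y
  constructor
  · rintro ⟨t, ht, rfl⟩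
    exact ⟨_, ht, rfl⟩
  · rintro ⟨x, hx, rfl⟩
    obtain ⟨t, rfl⟩ := Fr.exists_mk_eq x
    exact ⟨t, hx, rfl⟩

theorem embed_embed {γ δ ε : Ordinal.{u}} (h : γ ≤ δ) (h' : δ ≤ ε)
    (H : Extends (Set.inclusion (Set.Iio_subset_Iio h)) (extendRestr ρ γ) (extendRestr ρ δ))
    (H' : Extends (Set.inclusion (Set.Iio_subset_Iio h')) (extendRestr ρ δ) (extendRestr ρ ε))
    (H'' : Extends (Set.inclusion (Set.Iio_subset_Iio (h.trans h'))) (extendRestr ρ γ)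
      (extendRestr ρ ε)) (x : FrDim Λ ρ γ) : H'.embed (H.embed x) = H''.embed x := by
  obtain ⟨t, rfl⟩ := Fr.exists_mk_eq x
  simp only [Extends.embed_mk, Term.map_map]
  rfl

theorem extends_base
    (hρ : ∀ Γ : Finset (Set.Iio β), (⋃ η ∈ Γ, ρ η)ᶜ.Infinite)
    (n : ℕ) :
    Extends (Set.inclusion (Set.Iio_subset_Iio (le_dimN α n))) (extendRestr ρ α)
      (extendRestr ρ (dimN α n)) :=
  extends_inclusion hρ le_rfl (le_dimN α n) (dimN_le α n)

theorem extends_level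
    (hρ : ∀ Γ : Finset (Set.Iio β), (⋃ η ∈ Γ, ρ η)ᶜ.Infinite)
    {n m : ℕ} (h : n ≤ m) :
    Extends (Set.inclusion (Set.Iio_subset_Iio (dimN_mono α h))) (extendRestr ρ (dimN α n))
      (extendRestr ρ (dimN α m)) :=
  extends_inclusion hρ (le_dimN α n) (dimN_mono α h) (dimN_le α m)

theorem extends_limit
    (hρ : ∀ Γ : Finset (Set.Iio β), (⋃ η ∈ Γ, ρ η)ᶜ.Infinite)
    (n : ℕ) :
    Extends (Set.inclusion (Set.Iio_subset_Iio (dimN_le α n))) (extendRestr ρ (dimN α n))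
      (extendRestr ρ (α + ω * ω)) :=
  extends_inclusion hρ (le_dimN α n) (dimN_le α n) le_rfl

theorem image_push_level
    (hρ : ∀ Γ : Finset (Set.Iio β), (⋃ η ∈ Γ, ρ η)ᶜ.Infinite)
    {n m : ℕ} (h : n ≤ m) (X : Set (FrDim Λ ρ α)) :
    (extends_level hρ h).embed '' push (le_dimN α n) X = push (le_dimN α m) X := by
  rw [push_eq_image (extends_base hρ n), push_eq_image (extends_base hρ m), Set.image_image]
  exact Set.image_congr fun x _ => embed_embed (le_dimN α n) (dimN_mono α h) _ _ _ x

theorem embed_mem_sgN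
    (hρ : ∀ Γ : Finset (Set.Iio β), (⋃ η ∈ Γ, ρ η)ᶜ.Infinite)
    {n m : ℕ} (h : n ≤ m) {X : Set (FrDim Λ ρ α)} {a : FrDim Λ ρ (dimN α n)}
    (ha : a ∈ sgN n X) : (extends_level hρ h).embed a ∈ sgN m X := by
  rw [sgN, ← image_push_level hρ h]
  exact (extends_level hρ h).embed_mem_sg ha

theorem push_sgN_subset
    (hρ : ∀ Γ : Finset (Set.Iio β), (⋃ η ∈ Γ, ρ η)ᶜ.Infinite)
    {n m : ℕ} (h : n ≤ m) (X : Set (FrDim Λ ρ α)) :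
    push (dimN_le α n) (sgN n X) ⊆ push (dimN_le α m) (sgN m X) := by
  rw [push_eq_image (extends_limit hρ n), push_eq_image (extends_limit hρ m)]
  rintro _ ⟨a, ha, rfl⟩
  exact ⟨_, embed_mem_sgN hρ h ha, embed_embed (dimN_mono α h) (dimN_le α m) _ _ _ a⟩

/-- An element with non-empty dimension set generates, at a higher level, elements that do not
belong to a lower level. -/
theorem exists_mem_sgN_notMem_push
    (hρ : ∀ Γ : Finset (Set.Iio β), (⋃ η ∈ Γ, ρ η)ᶜ.Infinite)
    {k m : ℕ} (hkm : k < m) {X : Set (FrDim Λ ρ α)}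
    {x : FrDim Λ ρ α} (hx : x ∈ X) (hd : dimSet (Set.Iio α) x ≠ ∅) :
    ∃ a ∈ sgN m X, ∀ b : FrDim Λ ρ (dimN α k),
      (extends_limit hρ k).embed b ≠ (extends_limit hρ m).embed a ∧
      (extends_limit hρ k).embed b ≠ (extends_limit hρ m).embed aᶜ := by
  obtain ⟨i, hi⟩ := Set.nonempty_iff_ne_empty.mpr hd
  -- The first index missing from `B_k`. Both `s_j^i x` and its complement depend on it, so neither
  -- comes from `B_k`.
  let j : Set.Iio (dimN α m) := ⟨dimN α k, dimN_strictMono α hkm⟩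
  let i' : Set.Iio (dimN α m) := Set.inclusion (Set.Iio_subset_Iio (le_dimN α m)) i
  let x' := (extends_base hρ m).embed x
  have hj : ∀ i : Set.Iio α, Set.inclusion (Set.Iio_subset_Iio (le_dimN α m)) i ≠ j :=
    fun i hij => (lt_of_lt_of_le i.2 (le_dimN α k)).ne (congrArg Subtype.val hij)
  have hjx : MSA.c j x' = x' := c_eq_of_notMem_dimSet fun h => by
    obtain ⟨l, hl⟩ := (extends_base hρ m).dimSet_embed_subset x h
    exact hj l hl
  have hix : MSA.c i' x' ≠ x' := ((extends_base hρ m).mem_dimSet_embed i x).mpr hi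
  have hja : j ∈ dimSet _ (MSA.s j i' x') := fun h => hix (c_eq_of_c_s_eq (hj i) hjx h)
  have key : ∀ (a : FrDim Λ ρ (dimN α m)) (b : FrDim Λ ρ (dimN α k)), j ∈ dimSet _ a →
      (extends_limit hρ k).embed b ≠ (extends_limit hρ m).embed a := by
    intro a b ha hab
    have h1 := ((extends_limit hρ m).mem_dimSet_embed j a).mpr ha
    rw [← hab] at h1
    obtain ⟨l, hl⟩ := (extends_limit hρ k).dimSet_embed_subset b h1
    exact l.2.ne (congrArg Subtype.val hl)
  refine ⟨MSA.s j i' x', Sg.s _ _ _ (Sg.basic _ ?_), fun b => ⟨key _ b hja, key _ b ?_⟩⟩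
  · rw [push_eq_image (extends_base hρ m)]
    exact ⟨x, hx, rfl⟩
  · exact fun h => hja (c_compl_eq_iff.mp h)

variable {X₁ X₂ : Set (FrDim Λ ρ α)}

/-- At level `m`, primeness puts `a` or `-a` into the theory for every `a ∈ Sg X₁`, and into the
cotheory for every `a ∈ Sg X₂`. Saturation at level `k` makes all members come from `B_k`, which
fails for an `a` depending on an index outside `B_k`. -/
theorem dimSet_eq_empty_of_saturatedAt
    (hρ : ∀ Γ : Finset (Set.Iio β), (⋃ η ∈ Γ, ρ η)ᶜ.Infinite)
    {k m : ℕ} (hkm : k < m)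
    {w : Set (FrDim Λ ρ (α + ω * ω)) × Set (FrDim Λ ρ (α + ω * ω))}
    (hk : SaturatedAt X₁ X₂ k w) (hm : SaturatedAt X₁ X₂ m w) :
    (∀ x ∈ X₁, dimSet (Set.Iio α) x = ∅) ∧ ∀ x ∈ X₂, dimSet (Set.Iio α) x = ∅ := by
  obtain ⟨T, F, -, hT, hF⟩ := hk
  obtain ⟨T', F', hS, hT', hF'⟩ := hm
  rw [hT, push_eq_image (extends_limit hρ k), push_eq_image (extends_limit hρ m)] at hT'
  rw [hF, push_eq_image (extends_limit hρ k), push_eq_image (extends_limit hρ m)] at hF'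
  have hTk : ∀ a ∈ T', ∃ b, (extends_limit hρ k).embed b = (extends_limit hρ m).embed a := by
    intro a ha
    obtain ⟨b, -, hb⟩ := hT'.ge ⟨a, ha, rfl⟩
    exact ⟨b, hb⟩
  have hFk : ∀ a ∈ F', ∃ b, (extends_limit hρ k).embed b = (extends_limit hρ m).embed a := by
    intro a ha
    obtain ⟨b, -, hb⟩ := hF'.ge ⟨a, ha, rfl⟩
    exact ⟨b, hb⟩
  constructor
  · intro x hx
    by_contra hd
    obtain ⟨a, ha, hab⟩ := exists_mem_sgN_notMem_push hρ hkm hx hd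
    have h1 : a ⊔ aᶜ ∈ T' := by
      rw [sup_compl_eq_top]
      exact hS.theory.top_mem Sg.top
    rcases hS.prime_left a ha aᶜ ha.compl h1 with h | h
    · obtain ⟨b, hb⟩ := hTk _ h
      exact (hab b).1 hb
    · obtain ⟨b, hb⟩ := hTk _ h
      exact (hab b).2 hb
  · intro x hx
    by_contra hd
    obtain ⟨a, ha, hab⟩ := exists_mem_sgN_notMem_push hρ hkm hx hd
    have h1 : a ⊓ aᶜ ∈ F' := by
      rw [inf_compl_eq_bot]
      exact hS.cotheory.bot_mem Sg.bot
    rcases hS.prime_right a ha aᶜ ha.compl h1 with h | h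
    · obtain ⟨b, hb⟩ := hFk _ h
      exact (hab b).1 hb
    · obtain ⟨b, hb⟩ := hFk _ h
      exact (hab b).2 hb

theorem saturatedAt_zero_of_dimSet_eq_empty
    (hρ : ∀ Γ : Finset (Set.Iio β), (⋃ η ∈ Γ, ρ η)ᶜ.Infinite)
    (hX₁ : ∀ x ∈ X₁, dimSet (Set.Iio α) x = ∅)
    (hX₂ : ∀ x ∈ X₂, dimSet (Set.Iio α) x = ∅) {n : ℕ}
    {w : Set (FrDim Λ ρ (α + ω * ω)) × Set (FrDim Λ ρ (α + ω * ω))}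
    (hn : SaturatedAt X₁ X₂ n w) : SaturatedAt X₁ X₂ 0 w := by
  obtain ⟨T, F, hS, hT, hF⟩ := hn
  have hpush : ∀ {X : Set (FrDim Λ ρ α)}, (∀ x ∈ X, dimSet (Set.Iio α) x = ∅) →
      ∀ x ∈ push (le_dimN α 0) X, dimSet (Set.Iio (dimN α 0)) x = ∅ := by
    intro X hX x hx
    rw [push_eq_image (extends_base hρ 0)] at hx
    obtain ⟨x, hx, rfl⟩ := hx
    rw [Extends.dimSet_embed, hX x hx, Set.image_empty]
  rw [← image_push_level hρ n.zero_le, ← image_push_level hρ n.zero_le] at hS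
  obtain ⟨T₀, F₀, hS₀, rfl, rfl⟩ :=
    (extends_level hρ n.zero_le).exists_saturated_of_trivial (hpush hX₁) (hpush hX₂) hS
  refine ⟨T₀, F₀, hS₀, hT.trans ?_, hF.trans ?_⟩ <;>
  · rw [push_eq_image (extends_limit hρ n), push_eq_image (extends_limit hρ 0), Set.image_image]
    exact Set.image_congr fun x _ =>
      embed_embed (dimN_mono α n.zero_le) (dimN_le α n) _ _ _ x

theorem World.saturatedAt_level (w : World X₁ X₂) : SaturatedAt X₁ X₂ w.level w.1 :=
  Nat.sInf_mem w.2

/-- Otherwise `w'` is saturated at two levels, so `X₁` and `X₂` have only elements with empty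
dimension set, and `w` has level `0`. -/
theorem World.level_le_of_lt
    (hρ : ∀ Γ : Finset (Set.Iio β), (⋃ η ∈ Γ, ρ η)ᶜ.Infinite)
    (w w' : World X₁ X₂) {m : ℕ} (hm : w.level < m)
    (hw' : SaturatedAt X₁ X₂ m w'.1) : w.level ≤ w'.level := by
  by_contra! hlt
  obtain ⟨h₁, h₂⟩ :=
    dimSet_eq_empty_of_saturatedAt hρ (hlt.trans hm) w'.saturatedAt_level hw'
  have h0 := saturatedAt_zero_of_dimSet_eq_empty hρ h₁ h₂ w.saturatedAt_level
  have : w.level ≤ 0 := Nat.sInf_le h0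
  omega

/-! ### Seriality, reflexivity and transitivity -/

theorem exists_saturated_succ
    (hρ : ∀ Γ : Finset (Set.Iio β), (⋃ η ∈ Γ, ρ η)ᶜ.Infinite)
    (hα : Countable (Set.Iio α)) (hβ : Countable (Set.Iio β))
    (hD : dia (⊤ : FrDim Λ ρ α) = ⊤) {n : ℕ} {T F : Set (FrDim Λ ρ (dimN α n))}
    (hS : Saturated (Set.Iio (dimN α n)) (push (le_dimN α n) X₁) (push (le_dimN α n) X₂) T F) :
    ∃ T' F', Saturated (Set.Iio (dimN α (n + 1))) (push (le_dimN α (n + 1)) X₁)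
        (push (le_dimN α (n + 1)) X₂) T' F' ∧
      (∀ a ∈ sgN n X₁, box a ∈ T → (extends_level hρ n.le_succ).embed a ∈ T') ∧
      ∀ b ∈ sgN n X₂, dia b ∈ F → (extends_level hρ n.le_succ).embed b ∈ F' := by
  have hDn := (extends_base hρ n).valid_D hD
  have := countable_Iio_dimN hα (n + 1)
  set E := extends_level hρ n.le_succ
  have hX₁ := image_push_level hρ n.le_succ X₁
  have hX₂ := image_push_level hρ n.le_succ X₂
  have hfresh : ∀ (a : FrDim Λ ρ (dimN α n)), ∀ j ∈ (Set.range (Set.inclusion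
      (Set.Iio_subset_Iio (dimN_mono α n.le_succ))))ᶜ, j ∉ dimSet _ (E.embed a) :=
    fun a j hj h => hj (E.dimSet_embed_subset a h)
  suffices h : ∃ T' F', Saturated (Set.Iio (dimN α (n + 1))) (push (le_dimN α (n + 1)) X₁)
      (push (le_dimN α (n + 1)) X₂) T' F' ∧ E.embed '' {a | a ∈ sgN n X₁ ∧ box a ∈ T} ⊆ T' ∧
      -- Since `◇b = -□-b`, these `u` are the complements of the `b` with `◇b ∈ F`.
      ∀ u ∈ E.embed '' {u | u ∈ sgN n X₂ ∧ (box u)ᶜ ∈ F}, uᶜ ∈ F' by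
    obtain ⟨T', F', hS', hT', hF'⟩ := h
    refine ⟨T', F', hS', fun a ha haT => hT' ⟨a, ⟨ha, haT⟩, rfl⟩, fun b hb hbF => ?_⟩
    have := hF' (E.embed bᶜ) ⟨bᶜ, ⟨Sg.compl _ hb, hbF⟩, rfl⟩
    rwa [E.embed_compl, compl_compl] at this
  refine exists_saturated (infinite_compl_range_inclusion α n) E.finite_dimSet_inter
    (by rintro _ ⟨a, -, rfl⟩; exact hfresh a) (by rintro _ ⟨a, -, rfl⟩; exact hfresh a)
    (by rintro _ ⟨a, ha, rfl⟩; exact embed_mem_sgN hρ n.le_succ ha.1)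
    (by rintro _ ⟨a, ha, rfl⟩; exact embed_mem_sgN hρ n.le_succ ha.1)
    ⟨⊤, ⟨Sg.top, ?_⟩, rfl⟩ ⟨⊤, ⟨Sg.top, ?_⟩, rfl⟩ ?_ ?_ ?_
  · have : box (⊤ : FrDim Λ ρ (dimN α n)) = ⊤ := ModalAlgebra.box_top
    rw [this]
    exact hS.theory.top_mem Sg.top
  · have : box (⊤ : FrDim Λ ρ (dimN α n)) = ⊤ := ModalAlgebra.box_top
    rw [this, compl_top]
    exact hS.cotheory.bot_mem Sg.bot
  · rintro _ ⟨a, ⟨ha, haT⟩, rfl⟩ _ ⟨b, ⟨hb, hbT⟩, rfl⟩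
    refine ⟨a ⊓ b, ⟨Sg.inf _ _ ha hb, ?_⟩, E.embed_inf a b⟩
    exact hS.theory.mem_of_le
      (hS.theory.inf_mem haT hbT (Sg.inf _ _ (Sg.box _ ha) (Sg.box _ hb)))
      (box_inf_box_le a b) (Sg.box _ (Sg.inf _ _ ha hb))
  · rintro _ ⟨a, ⟨ha, haF⟩, rfl⟩ _ ⟨b, ⟨hb, hbF⟩, rfl⟩
    refine ⟨a ⊓ b, ⟨Sg.inf _ _ ha hb, ?_⟩, E.embed_inf a b⟩
    refine hS.cotheory.mem_of_le (hS.cotheory.sup_mem haF hbF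
      (Sg.sup _ _ (Sg.compl _ (Sg.box _ ha)) (Sg.compl _ (Sg.box _ hb)))) ?_
      (Sg.compl _ (Sg.box _ (Sg.inf _ _ ha hb)))
    rw [← compl_inf]
    exact compl_le_compl (box_inf_box_le a b)
  · rintro _ ⟨t, ⟨ht, htT⟩, rfl⟩ _ ⟨u, ⟨hu, huF⟩, rfl⟩ c ⟨hc₁, hc₂⟩ htc huc
    rw [← hX₁] at hc₁
    rw [← hX₂] at hc₂
    -- The separator is brought down to `B_n`, where `T` and `F` live; there `□w` falls into both.
    obtain ⟨w, hw₁, hw₂, htw, huw⟩ := E.exists_separator hc₁ hc₂ htc huc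
    have h1 : box w ∈ T := hS.theory.mem_of_le htT (box_le_box htw) (Sg.box _ hw₁)
    have h2 : box w ∈ F := by
      refine hS.cotheory.mem_of_le huF ?_ (Sg.box _ hw₂)
      refine (box_le_dia hDn w).trans ?_
      rw [← dia_compl]
      exact dia_le_dia (le_compl_comm.mp huw)
    exact (hS.disjoint ▸ Set.mem_inter h1 h2 : box w ∈ (∅ : Set _))

theorem World.acc_serial
    (hρ : ∀ Γ : Finset (Set.Iio β), (⋃ η ∈ Γ, ρ η)ᶜ.Infinite)
    (hα : Countable (Set.Iio α)) (hβ : Countable (Set.Iio β))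
    (hD : dia (⊤ : FrDim Λ ρ α) = ⊤) (x : World X₁ X₂) : ∃ y, x.Acc y := by
  obtain ⟨T, F, hS, hT, hF⟩ := x.saturatedAt_level
  obtain ⟨T', F', hS', hTT', hFF'⟩ := exists_saturated_succ hρ hα hβ hD hS
  have hy : SaturatedAt X₁ X₂ (x.level + 1) (push (dimN_le α _) T', push (dimN_le α _) F') :=
    ⟨T', F', hS', rfl, rfl⟩
  refine ⟨⟨_, _, hy⟩, World.level_le_of_lt hρ _ _ x.level.lt_succ_self hy, ?_, ?_⟩
  · intro a ha hbox
    rw [push_eq_image (extends_limit hρ _)] at ha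
    obtain ⟨a, ha, rfl⟩ := ha
    rw [hT, push_eq_image (extends_limit hρ _), ← Extends.embed_box,
      (extends_limit hρ _).embed_injective.mem_set_image] at hbox
    change _ ∈ push (dimN_le α _) T'
    rw [push_eq_image (extends_limit hρ _)]
    exact ⟨_, hTT' a ha hbox, embed_embed (dimN_mono α x.level.le_succ) (dimN_le α _) _ _ _ a⟩
  · intro b hb hdia
    rw [push_eq_image (extends_limit hρ _)] at hb
    obtain ⟨b, hb, rfl⟩ := hb
    rw [hF, push_eq_image (extends_limit hρ _), ← Extends.embed_dia,
      (extends_limit hρ _).embed_injective.mem_set_image] at hdia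
    change _ ∈ push (dimN_le α _) F'
    rw [push_eq_image (extends_limit hρ _)]
    exact ⟨_, hFF' b hb hdia, embed_embed (dimN_mono α x.level.le_succ) (dimN_le α _) _ _ _ b⟩

theorem World.mem_fst_of_le
    (hρ : ∀ Γ : Finset (Set.Iio β), (⋃ η ∈ Γ, ρ η)ᶜ.Infinite)
    (x : World X₁ X₂) {a b : FrDim Λ ρ (dimN α x.level)}
    (hab : a ≤ b) (hb : b ∈ sgN x.level X₁) (ha : (extends_limit hρ x.level).embed a ∈ x.1.1) :
    (extends_limit hρ x.level).embed b ∈ x.1.1 := by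
  obtain ⟨T, F, hS, hT, -⟩ := x.saturatedAt_level
  rw [hT, push_eq_image (extends_limit hρ _),
    (extends_limit hρ _).embed_injective.mem_set_image] at ha ⊢
  exact hS.theory.mem_of_le ha hab hb

theorem World.mem_snd_of_le
    (hρ : ∀ Γ : Finset (Set.Iio β), (⋃ η ∈ Γ, ρ η)ᶜ.Infinite)
    (x : World X₁ X₂) {a b : FrDim Λ ρ (dimN α x.level)}
    (hab : b ≤ a) (hb : b ∈ sgN x.level X₂) (ha : (extends_limit hρ x.level).embed a ∈ x.1.2) :
    (extends_limit hρ x.level).embed b ∈ x.1.2 := by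
  obtain ⟨T, F, hS, -, hF⟩ := x.saturatedAt_level
  rw [hF, push_eq_image (extends_limit hρ _),
    (extends_limit hρ _).embed_injective.mem_set_image] at ha ⊢
  exact hS.cotheory.mem_of_le ha hab hb

theorem World.acc_refl
    (hρ : ∀ Γ : Finset (Set.Iio β), (⋃ η ∈ Γ, ρ η)ᶜ.Infinite)
    (hT : ∀ p : FrDim Λ ρ α, (box p)ᶜ ⊔ p = ⊤) (x : World X₁ X₂) :
    x.Acc x := by
  have hTn := (extends_base hρ x.level).valid_T hT
  refine ⟨le_rfl, fun a ha hbox => ?_, fun b hb hdia => ?_⟩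
  · rw [push_eq_image (extends_limit hρ _)] at ha
    obtain ⟨a, ha, rfl⟩ := ha
    rw [← Extends.embed_box] at hbox
    exact x.mem_fst_of_le hρ (box_le_self hTn a) ha hbox
  · rw [push_eq_image (extends_limit hρ _)] at hb
    obtain ⟨b, hb, rfl⟩ := hb
    rw [← Extends.embed_dia] at hdia
    exact x.mem_snd_of_le hρ (le_dia_self hTn b) hb hdia

theorem World.acc_trans
    (hρ : ∀ Γ : Finset (Set.Iio β), (⋃ η ∈ Γ, ρ η)ᶜ.Infinite)
    (h4 : ∀ p : FrDim Λ ρ α, (box p)ᶜ ⊔ box (box p) = ⊤)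
    {x y z : World X₁ X₂} (hxy : x.Acc y) (hyz : y.Acc z) : x.Acc z := by
  have h4n := (extends_base hρ x.level).valid_four h4
  refine ⟨hxy.1.trans hyz.1, fun a ha hbox => ?_, fun b hb hdia => ?_⟩
  · refine hyz.2.1 a (push_sgN_subset hρ hxy.1 _ ha) ?_
    rw [push_eq_image (extends_limit hρ _)] at ha
    obtain ⟨a, ha, rfl⟩ := ha
    rw [← Extends.embed_box] at hbox ⊢
    refine hxy.2.1 _ ?_ ?_
    · rw [push_eq_image (extends_limit hρ _)]
      exact ⟨_, Sg.box _ ha, rfl⟩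
    · rw [← Extends.embed_box]
      exact x.mem_fst_of_le hρ (box_le_box_box h4n a) (Sg.box _ (Sg.box _ ha)) hbox
  · refine hyz.2.2 b (push_sgN_subset hρ hxy.1 _ hb) ?_
    rw [push_eq_image (extends_limit hρ _)] at hb
    obtain ⟨b, hb, rfl⟩ := hb
    rw [← Extends.embed_dia] at hdia ⊢
    refine hxy.2.2 _ ?_ ?_
    · rw [push_eq_image (extends_limit hρ _)]
      exact ⟨_, sg_dia_mem hb, rfl⟩
    · rw [← Extends.embed_dia]
      exact x.mem_snd_of_le hρ (dia_dia_le h4n b) (sg_dia_mem (sg_dia_mem hb)) hdia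

end Levels

end QML
theorem mainTheorem2 {α β : Ordinal.{u}} (hα : Ordinal.omega0 ≤ α)
    (Λ : Set QML.ModalAxiom) (ρ : Set.Iio β → Set (Set.Iio α))
    (hρ : ∀ Γ : Finset (Set.Iio β), (⋃ η ∈ Γ, ρ η)ᶜ.Infinite)
    (X₁ X₂ : Set (QML.FrDim Λ ρ α)) :
    (Countable (Set.Iio α) → Countable (Set.Iio β) →
      QML.dia (⊤ : QML.FrDim Λ ρ α) = ⊤ →
        ∀ x, ∃ y, (QML.canonicalKripke X₁ X₂ hα).Rel x y) ∧
    ((∀ p : QML.FrDim Λ ρ α, (QML.box p)ᶜ ⊔ p = ⊤) →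
        ∀ x, (QML.canonicalKripke X₁ X₂ hα).Rel x x) ∧
    ((∀ p : QML.FrDim Λ ρ α, (QML.box p)ᶜ ⊔ QML.box (QML.box p) = ⊤) →
        ∀ x y z, (QML.canonicalKripke X₁ X₂ hα).Rel x y →
          (QML.canonicalKripke X₁ X₂ hα).Rel y z → (QML.canonicalKripke X₁ X₂ hα).Rel x z) ∧
    (Countable (Set.Iio α) → Countable (Set.Iio β) → QML.ModalAxiom.D ∈ Λ →
        ∀ x, ∃ y, (QML.canonicalKripke X₁ X₂ hα).Rel x y) ∧
    (QML.ModalAxiom.T ∈ Λ → ∀ x, (QML.canonicalKripke X₁ X₂ hα).Rel x x) ∧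
    (QML.ModalAxiom.four ∈ Λ →
        ∀ x y z, (QML.canonicalKripke X₁ X₂ hα).Rel x y →
          (QML.canonicalKripke X₁ X₂ hα).Rel y z → (QML.canonicalKripke X₁ X₂ hα).Rel x z) := by

  have serial : Countable (Set.Iio α) → Countable (Set.Iio β) →
      QML.dia (⊤ : QML.FrDim Λ ρ α) = ⊤ →
        ∀ x, ∃ y, (QML.canonicalKripke X₁ X₂ hα).Rel x y :=
    fun h₁ h₂ hD x => QML.World.acc_serial hρ h₁ h₂ hD x
  have refl : (∀ p : QML.FrDim Λ ρ α, (QML.box p)ᶜ ⊔ p = ⊤) →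
      ∀ x, (QML.canonicalKripke X₁ X₂ hα).Rel x x :=
    fun hT x => QML.World.acc_refl hρ hT x
  have trans : (∀ p : QML.FrDim Λ ρ α, (QML.box p)ᶜ ⊔ QML.box (QML.box p) = ⊤) →
      ∀ x y z, (QML.canonicalKripke X₁ X₂ hα).Rel x y →
        (QML.canonicalKripke X₁ X₂ hα).Rel y z → (QML.canonicalKripke X₁ X₂ hα).Rel x z :=
    fun h4 _ _ _ hxy hyz => QML.World.acc_trans hρ h4 hxy hyz
  exact ⟨serial, refl, trans, fun h₁ h₂ hD => serial h₁ h₂ (QML.Fr.valid_D hD),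
    fun hT => refl (QML.Fr.valid_T hT), fun h4 => trans (QML.Fr.valid_four h4)⟩
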